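/- **Theorem (Abel's Theorem, $h$-deformed).** Let $h\in\mathbb C$, $h\ne 0$, and let $I$ be a linearly ordered set with a distinguished element $0\in I$. Let $H_I$ be the complex unital algebra with generators $x_i,y_i$ ($i\in I$) and relations $x_iy_i=y_ix_i+hy_i^2$ and, for $i<j$, $$x_jy_i=y_ix_j+hy_iy_j,\quad y_jx_i=x_iy_j-hy_iy_j,\quad y_jy_i=y_iy_j,\quad x_jx_i=x_ix_j-hx_iy_j+hy_ix_j+h^2y_iy_j.$$ Let $Q_I$ be the right quotient division ring of $H_I$, and $Q_{I\setminus\{0\}}\subset Q_I$ the skew subfield generated over $\mathbb C$ by $x_i,y_i$, $i\neq 0$. For pairs $u=(X,Y)$, $v=(X',Y')$ put $(uv)=XY'-YX'-hYY'$; an index $i\in I$ in a bracket stands for the pair $(x_i,y_i)$, and $x=x_0$, $y=y_0$. Let $K\subset I$ with $0\in K$, let $g\ge 1$ and $0\le s\le 2g+2$, and let $i_1,\dots,i_{2g+2},j_1,\dots,j_{g-1}\in I\setminus K$ and $k_1,\dots,k_p,l_1,\dots,l_q\in K\setminus\{0\}$, where the $i$'s, $k$'s and $l$'s are all different and $p-q=g+1-s$.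 Put $P=(0k_1)\cdots(0k_p)$, $Q=(0l_1)\cdots(0l_q)$, $k=s+2p=2g+2-s+2q$ and $$r=(0i_1)\cdots(0i_s)\,P^2-(0i_{s+1})\cdots(0i_{2g+2})\,Q^2 .$$ Let $L$ be a skew field extension of $Q_I$ generated over $Q_I$ by a set $\Sigma$ of central elements of $L$ that are algebraic over $Q_{I\setminus\{0\}}$ together with central elements $W^{(1)},\dots,W^{(k)}$ of $L$. Suppose that in $L$ $$r=C\,(0X_1)\cdots(0X_k),\qquad (0X_i):=xY_i-yX_i-hyY_i,$$ with $C,X_i,Y_i\in Q_{I\setminus\{0\}}[\Sigma]$ and all linear forms $(0X_i)$ central in $L$, and that $$(W^{(i)})^2=(X_ii_1)\cdots(X_ii_{2g+2}),\qquad (X_ij):=X_iy_j-Y_ix_j-hY_iy_j .$$ Let $\Gamma=L\,d_K L$ be the $L$-bimodule generated by symbols $da$, $a\in L$, with the following relations: $d$ is $\mathbb C$-linear, $d(ab)=da\cdot b+a\,db$ and $d1=0$; $dx_i=dy_i=0$ for $i\notin K$; for $i\in I$, $j\in K$, $$dx_j\,x_i=x_i\,dx_j-hx_i\,dy_j+hy_i\,dx_j+h^2y_i\,dy_j,\quad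 dy_j\,y_i=y_i\,dy_j,\quad dx_j\,y_i=y_i\,dx_j+hy_i\,dy_j,\quad dy_j\,x_i=x_i\,dy_j-hy_i\,dy_j;$$ and $\sigma\,da=da\,\sigma$, $a\,d\sigma=d\sigma\,a$ for $a\in L$ and $\sigma\in\Sigma\cup\{W^{(1)},\dots,W^{(k)}\}$. Define the hyperelliptic differentials of the first kind $$dh_{X_i,Y_i}=(W^{(i)})^{-1}\,(X_ij_1)\cdots(X_ij_{g-1})\,\bigl(dX_i\cdot Y_i-dY_i\cdot X_i-h\,dY_i\cdot Y_i\bigr)\in\Gamma .$$ Then there are signs $\epsilon_1,\dots,\epsilon_k\in\{1,-1\}$ with $$\epsilon_1\,dh_{X_1,Y_1}+\cdots+\epsilon_k\,dh_{X_k,Y_k}=0\quad\text{in }\Gamma .$$ -/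

import Mathlib

open scoped TensorProduct

noncomputable section

namespace HDeformed

/-! ### The algebra of noncommutative homogeneous coordinates -/

/-- The free generator `x_i`. -/
def freeX {I : Type*} (i : I) : FreeAlgebra ℂ (I ⊕ I) := FreeAlgebra.ι ℂ (Sum.inl i)

/-- The free generator `y_i`. -/
def freeY {I : Type*} (i : I) : FreeAlgebra ℂ (I ⊕ I) := FreeAlgebra.ι ℂ (Sum.inr i)

/-- The defining relations of the `h`-deformed coordinate algebra. -/
inductive HRel (h : ℂ) (I : Type*) [LinearOrder I] :
    FreeAlgebra ℂ (I ⊕ I) → FreeAlgebra ℂ (I ⊕ I) → Prop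
  | xy_self (i : I) :
      HRel h I (freeX i * freeY i) (freeY i * freeX i + h • (freeY i * freeY i))
  | xy {i j : I} (hij : i < j) :
      HRel h I (freeX j * freeY i) (freeY i * freeX j + h • (freeY i * freeY j))
  | yx {i j : I} (hij : i < j) :
      HRel h I (freeY j * freeX i) (freeX i * freeY j - h • (freeY i * freeY j))
  | yy {i j : I} (hij : i < j) :
      HRel h I (freeY j * freeY i) (freeY i * freeY j)
  | xx {i j : I} (hij : i < j) :
      HRel h I (freeX j * freeX i)
        (freeX i * freeX j - h • (freeX i * freeY j) + h • (freeY i * freeX j)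
          + h ^ 2 • (freeY i * freeY j))

/-- The algebra `H_I`: the complex unital algebra with generators `x_i, y_i` (`i ∈ I`) and the
above relations. -/
abbrev HAlg (h : ℂ) (I : Type*) [LinearOrder I] : Type _ := RingQuot (HRel h I)

/-- The coordinate `x_i ∈ H_I`. -/
def coordX (h : ℂ) {I : Type*} [LinearOrder I] (i : I) : HAlg h I :=
  RingQuot.mkAlgHom ℂ (HRel h I) (freeX i)

/-- The coordinate `y_i ∈ H_I`. -/
def coordY (h : ℂ) {I : Type*} [LinearOrder I] (i : I) : HAlg h I :=
  RingQuot.mkAlgHom ℂ (HRel h I) (freeY i)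

/-- `Q` is the right quotient division ring of the ring `H` (through `j : H → Q`): `H` embeds in
the division ring `Q`, and every element of `Q` is a right quotient `a b⁻¹` with `a, b ∈ H`,
`b ≠ 0`. This determines `Q` up to a unique isomorphism over `H`. -/
structure IsRightQuotientDivisionRing {H Q : Type*} [Ring H] [Algebra ℂ H] [DivisionRing Q]
    [Algebra ℂ Q] (j : H →ₐ[ℂ] Q) : Prop where
  injective : Function.Injective j
  exists_quotient : ∀ q : Q, ∃ a b : H, b ≠ 0 ∧ q = j a * (j b)⁻¹

/-- For `j : H_I → Q_I` and `J ⊆ I`: the skew subfield `Q_J` of `Q_I` generated over `ℂ` by the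
coordinates `x_i, y_i` with `i ∈ J`. -/
def subQuot {h : ℂ} {I : Type*} [LinearOrder I] {Q : Type*} [DivisionRing Q] [Algebra ℂ Q]
    (j : HAlg h I →ₐ[ℂ] Q) (J : Set I) : Subfield Q :=
  Subfield.closure (Set.range (algebraMap ℂ Q) ∪ (fun i => j (coordX h i)) '' J
    ∪ (fun i => j (coordY h i)) '' J)

/-! ### Brackets -/

/-- The bracket `(u v) = X Y' - Y X' - h Y Y'` of two points `u = (X, Y)`, `v = (X', Y')` given by
noncommutative homogeneous coordinates in a complex algebra. -/
def br {L : Type*} [Ring L] [Algebra ℂ L] (h : ℂ) (u v : L × L) : L :=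
  u.1 * v.2 - u.2 * v.1 - h • (u.2 * v.2)

/-- The product `(u j₁)(u j₂)⋯(u jₙ)` of the brackets of the point `u` with the points
`z j₁, …, z jₙ`; it is `1` for the empty list. -/
def brProd {I L : Type*} [Ring L] [Algebra ℂ L] (h : ℂ) (z : I → L × L) (u : L × L)
    (l : List I) : L :=
  (l.map fun j => br h u (z j)).prod

/-! ### Differential modules -/

/-- The enveloping algebra `L ⊗ Lᵒᵖ` of `L`; its left modules are the `L`-bimodules on which the
two actions of `ℂ` agree. -/
def Env (L : Type*) [Ring L] [Algebra ℂ L] : Type _ := L ⊗[ℂ] Lᵐᵒᵖ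

instance (L : Type*) [Ring L] [Algebra ℂ L] : Ring (Env L) :=
  inferInstanceAs (Ring (L ⊗[ℂ] Lᵐᵒᵖ))

instance (L : Type*) [Ring L] [Algebra ℂ L] : Algebra ℂ (Env L) :=
  inferInstanceAs (Algebra ℂ (L ⊗[ℂ] Lᵐᵒᵖ))

/-- The element `a ⊗ b` of the enveloping algebra; it acts on a bimodule by `m ↦ a · m · b`. -/
def envMk {L : Type*} [Ring L] [Algebra ℂ L] (a b : L) : Env L :=
  (a ⊗ₜ[ℂ] MulOpposite.op b : L ⊗[ℂ] Lᵐᵒᵖ)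

/-- The left action `a · m` on a bimodule. -/
def lact {L M : Type*} [Ring L] [Algebra ℂ L] [AddCommGroup M] [Module (Env L) M]
    (a : L) (m : M) : M :=
  envMk a 1 • m

/-- The right action `m · b` on a bimodule. -/
def ract {L M : Type*} [Ring L] [Algebra ℂ L] [AddCommGroup M] [Module (Env L) M]
    (m : M) (b : L) : M :=
  envMk 1 b • m

/-- The symbol `d a` in the free `L`-bimodule on the symbols `d a`, `a ∈ L`. -/
def freeD {L : Type*} [Ring L] [Algebra ℂ L] (a : L) : L →₀ Env L := Finsupp.single a 1

/-- The defining relations of the differential module `L d_K L`. Here `z i = (x_i, y_i)` are the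
coordinates, those with `i ∈ K` are variables, those with `i ∉ K` are constants, and `S` is the
set of the central elements that have been adjoined. -/
inductive DRel {I L : Type*} [Ring L] [Algebra ℂ L] (h : ℂ) (z : I → L × L) (K : Set I)
    (S : Set L) : (L →₀ Env L) → Prop
  | linear (α β : ℂ) (a b : L) :
      DRel h z K S (freeD (α • a + β • b) - α • freeD a - β • freeD b)
  | leibniz (a b : L) :
      DRel h z K S (freeD (a * b) - ract (freeD a) b - lact a (freeD b))
  | one : DRel h z K S (freeD 1)
  | const_x (i : I) (hi : i ∉ K) : DRel h z K S (freeD (z i).1)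
  | const_y (i : I) (hi : i ∉ K) : DRel h z K S (freeD (z i).2)
  | dx_x (i j : I) (hj : j ∈ K) :
      DRel h z K S (ract (freeD (z j).1) (z i).1 - lact (z i).1 (freeD (z j).1)
        + h • lact (z i).1 (freeD (z j).2) - h • lact (z i).2 (freeD (z j).1)
        - h ^ 2 • lact (z i).2 (freeD (z j).2))
  | dy_y (i j : I) (hj : j ∈ K) :
      DRel h z K S (ract (freeD (z j).2) (z i).2 - lact (z i).2 (freeD (z j).2))
  | dx_y (i j : I) (hj : j ∈ K) :
      DRel h z K S (ract (freeD (z j).1) (z i).2 - lact (z i).2 (freeD (z j).1)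
        - h • lact (z i).2 (freeD (z j).2))
  | dy_x (i j : I) (hj : j ∈ K) :
      DRel h z K S (ract (freeD (z j).2) (z i).1 - lact (z i).1 (freeD (z j).2)
        + h • lact (z i).2 (freeD (z j).2))
  | central_left (σ : L) (hσ : σ ∈ S) (a : L) :
      DRel h z K S (lact σ (freeD a) - ract (freeD a) σ)
  | central_right (σ : L) (hσ : σ ∈ S) (a : L) :
      DRel h z K S (lact a (freeD σ) - ract (freeD σ) a)

/-- The differential module `Γ = L d_K L`: the `L`-bimodule generated by the symbols `d a`,
`a ∈ L`, subject to the relations above. -/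
abbrev DiffModule {I L : Type*} [Ring L] [Algebra ℂ L] (h : ℂ) (z : I → L × L) (K : Set I)
    (S : Set L) : Type _ :=
  (L →₀ Env L) ⧸ Submodule.span (Env L) {m | DRel h z K S m}

/-- The total differential `d = d_K : L → Γ`. -/
def dK {I L : Type*} [Ring L] [Algebra ℂ L] (h : ℂ) (z : I → L × L) (K : Set I) (S : Set L)
    (a : L) : DiffModule h z K S :=
  Submodule.Quotient.mk (freeD a)

/-- The bracket `(du, u) = dX · Y - dY · X - h dY · Y` of a point `u = (X, Y)`. -/
def dbr {I L : Type*} [Ring L] [Algebra ℂ L] (h : ℂ) (z : I → L × L) (K : Set I) (S : Set L)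
    (u : L × L) : DiffModule h z K S :=
  ract (dK h z K S u.1) u.2 - ract (dK h z K S u.2) u.1 - h • ract (dK h z K S u.2) u.2

/-- The `h`-deformed hyperelliptic differential of the first kind at the point `u = (X, Y)`,
`dh_{X,Y} = w⁻¹ (u j₁)⋯(u j_{g-1}) (du, u)`, where `w` is a square root of
`(u i₁)⋯(u i_{2g+2})`. -/
def dh {I L : Type*} [DivisionRing L] [Algebra ℂ L] (h : ℂ) (z : I → L × L) (K : Set I)
    (S : Set L) (js : List I) (w : L) (u : L × L) : DiffModule h z K S :=
  lact (w⁻¹ * brProd h z u js) (dbr h z K S u)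

end HDeformed

end

open scoped TensorProduct

noncomputable section

namespace HDeformed

/-! Relative to a constant base point $b$, chosen among the $i$'s, the geometry becomes commutative.
The brackets $A_i=(ib)$ and the quotients $B_i=y_iy_b^{-1}$ commute with all coordinates, hence are
central in $L$. Each pair $(x_i,y_i)$ is recovered from $(A_i,B_i)$ by `pt`, and the deformed
bracket of two such points is the ordinary determinant (`br_pt`). Translations of a single point
show that its coordinates are algebraically independent over the central elements coming from the
other points (`algebraicIndependent_coords`). Applied to the point $0$, this forces a central form
$(0X_l)$ to come from a point $\pi_l$ with central coordinates, algebraic over the central part of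
$Q_{I\setminus\{0\}}$ (`exists_central_point`). By genericity of the point $0$, the factorization of
$r$ is then an identity of binary forms over the field $Z(L)$.

In $\Gamma$ the center commutes with all differentials (`lact_center_dK`), so a functional $f$ on
$\Gamma$ that is linear over the center turns $d$ into an ordinary derivation $f\circ d$ of $Z(L)$.
Such functionals detect zero, and what remains is Abel's theorem over a field with a derivation $D$
(`exists_signs_sum_eq_zero`).

There $aP^2-bQ^2=C\prod_l\det(\cdot,\pi_l)$, where $D$ kills the coordinates of the points defining
$a$ and $b$. At the root $\pi_l$ the relation $w^2=ab$ gives $aP=\epsilon wQ$ and $bQ=\epsilon wP$.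
Letting $D$ act on the coefficients while the argument stays fixed at $\pi_l$ identifies the $l$-th
differential with $-2/C$ times $F(\pi_l)/\prod_{m\ne l}\det(\pi_l,\pi_m)$, where
$F=(j_1)\cdots(j_{g-1})(QP'-PQ')$ has degree $k-2$. The sum vanishes by the Euler–Jacobi relation
(`sum_residue`). This needs distinct roots: the identity involves a generic linear form, and at a
double root both coordinates of its generic point would be rational in a single parameter
(`det₂_ne_zero_of_pencil`). -/

/-- The relations, bilinear in `u` and `v`, that hold between any two coordinate pairs. -/
structure HPair (h : ℂ) {A : Type*} [Ring A] [Algebra ℂ A] (u v : A × A) : Prop where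
  xy : v.1 * u.2 = u.2 * v.1 + h • (u.2 * v.2)
  yx : v.2 * u.1 = u.1 * v.2 - h • (u.2 * v.2)
  yy : v.2 * u.2 = u.2 * v.2
  xx : v.1 * u.1 = u.1 * v.1 - h • (u.1 * v.2) + h • (u.2 * v.1) + h ^ 2 • (u.2 * v.2)

/-! ### Coordinate pairs and the centrality of brackets -/

namespace HPair

variable {h : ℂ} {A : Type*} [Ring A] [Algebra ℂ A] {u v w : A × A}

/-- The relations imposed for $i<j$ imply the same relations with the two pairs exchanged, so the
order on $I$ plays no role from here on. -/
theorem symm (H : HPair h u v) : HPair h v u := by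
  have h1 := H.xy
  have h2 := H.yx
  have h3 := H.yy
  have h4 := H.xx
  refine ⟨?_, ?_, h3.symm, ?_⟩
  · rw [h2, h3]; abel
  · rw [h1, h3]; abel
  · rw [h4, h1, h2, h3, smul_add, smul_sub, smul_smul, sq]; abel

theorem self (H : u.1 * u.2 = u.2 * u.1 + h • (u.2 * u.2)) : HPair h u u := by
  refine ⟨H, ?_, rfl, ?_⟩
  · rw [H]; abel
  · rw [H, smul_add, smul_smul, sq]; abel

/-- Bilinearity is what makes linear combinations of coordinate pairs admissible as new points; the
operator model and the translations below rest on it. -/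
theorem add_right (H : HPair h u v) (H' : HPair h u w) : HPair h u (v + w) := by
  refine ⟨?_, ?_, ?_, ?_⟩ <;> simp only [Prod.fst_add, Prod.snd_add, add_mul, mul_add, smul_add]
  · rw [H.xy, H'.xy]; abel
  · rw [H.yx, H'.yx]; abel
  · rw [H.yy, H'.yy]
  · rw [H.xx, H'.xx]; abel

theorem smul_right (H : HPair h u v) (c : ℂ) : HPair h u (c • v) := by
  refine ⟨?_, ?_, ?_, ?_⟩ <;>
    simp only [Prod.smul_fst, Prod.smul_snd, smul_mul_assoc, mul_smul_comm]
  · rw [H.xy, smul_add, smul_comm c]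
  · rw [H.yx, smul_sub, smul_comm c]
  · rw [H.yy]
  · rw [H.xx]; simp only [smul_add, smul_sub, smul_comm c]

theorem add_left (H : HPair h u w) (H' : HPair h v w) : HPair h (u + v) w :=
  (H.symm.add_right H'.symm).symm

theorem smul_left (H : HPair h u v) (c : ℂ) : HPair h (c • u) v :=
  (H.symm.smul_right c).symm

theorem map {B : Type*} [Ring B] [Algebra ℂ B] (f : A →ₐ[ℂ] B) (H : HPair h u v) :
    HPair h (f u.1, f u.2) (f v.1, f v.2) := by
  refine ⟨?_, ?_, ?_, ?_⟩ <;> dsimp only <;>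
    simp only [← map_mul, ← map_smul, ← map_add, ← map_sub]
  exacts [congrArg f H.xy, congrArg f H.yx, congrArg f H.yy, congrArg f H.xx]

/-- The bracket of two coordinate pairs, written without `h`. -/
theorem br_eq (H : HPair h u v) : br h u v = u.1 * v.2 - v.1 * u.2 := by
  rw [br, H.xy]; abel

/-- Moving `w.2` across `u.1` and across `v.1` produces one correction in $h$ for each term of
`br_eq`; these cancel because the second coordinates commute. -/
theorem commute_br_snd (H : HPair h u v) (Hu : HPair h u w) (Hv : HPair h v w) :
    Commute w.2 (br h u v) := by
  rw [H.br_eq, Commute, SemiconjBy]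
  have e (t : A) : v.2 * (u.2 * t) = u.2 * (v.2 * t) := by rw [← mul_assoc, H.yy, mul_assoc]
  simp only [mul_sub, sub_mul, ← mul_assoc, Hu.yx, Hv.yx, smul_mul_assoc]
  simp only [mul_assoc, Hu.yy, Hv.yy, e]
  abel

theorem commute_br_fst (H : HPair h u v) (Hu : HPair h u w) (Hv : HPair h v w) :
    Commute w.1 (br h u v) := by
  rw [H.br_eq, Commute, SemiconjBy]
  simp only [mul_sub, sub_mul, ← mul_assoc, Hu.xx, Hv.xx, add_mul, smul_mul_assoc]
  simp only [mul_assoc, Hu.xy, Hv.xy, mul_add, mul_smul_comm, Hu.yy, Hv.yy]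
  have e (t : A) : v.2 * (u.2 * t) = u.2 * (v.2 * t) := by rw [← mul_assoc, H.yy, mul_assoc]
  simp only [e, smul_add]
  abel

end HPair

variable (h : ℂ) {I : Type*} [LinearOrder I]

theorem HAlg.hPair (i j : I) :
    HPair h (coordX h i, coordY h i) (coordX h j, coordY h j) := by
  have key : ∀ {i j : I}, i < j → HPair h (coordX h i, coordY h i) (coordX h j, coordY h j) := by
    intro i j hij
    refine ⟨?_, ?_, ?_, ?_⟩
    · simpa [coordX, coordY] using RingQuot.mkAlgHom_rel ℂ (HRel.xy (h := h) hij)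
    · simpa [coordX, coordY] using RingQuot.mkAlgHom_rel ℂ (HRel.yx (h := h) hij)
    · simpa [coordX, coordY] using RingQuot.mkAlgHom_rel ℂ (HRel.yy (h := h) hij)
    · simpa [coordX, coordY] using RingQuot.mkAlgHom_rel ℂ (HRel.xx (h := h) hij)
  rcases lt_trichotomy i j with hij | rfl | hij
  · exact key hij
  · refine HPair.self ?_
    simpa [coordX, coordY] using RingQuot.mkAlgHom_rel ℂ (HRel.xy_self (h := h) i)
  · exact (key hij).symm

/-- A family of pairs satisfying the relations induces a homomorphism from `H_I`. -/
def HAlg.lift {A : Type*} [Ring A] [Algebra ℂ A] (z : I → A × A)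
    (hz : ∀ i j, HPair h (z i) (z j)) : HAlg h I →ₐ[ℂ] A :=
  RingQuot.liftAlgHom ℂ ⟨FreeAlgebra.lift ℂ (Sum.elim (fun i => (z i).1) fun i => (z i).2), by
    intro a b hab
    cases hab with
    | xy_self i => simpa [freeX, freeY] using (hz i i).xy
    | @xy i j _ => simpa [freeX, freeY] using (hz i j).xy
    | @yx i j _ => simpa [freeX, freeY] using (hz i j).yx
    | @yy i j _ => simpa [freeX, freeY] using (hz i j).yy
    | @xx i j _ => simpa [freeX, freeY] using (hz i j).xx⟩

section
variable {h} {A : Type*} [Ring A] [Algebra ℂ A] (z : I → A × A) (hz : ∀ i j, HPair h (z i) (z j))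

@[simp] theorem HAlg.lift_coordX (i : I) : HAlg.lift h z hz (coordX h i) = (z i).1 := by
  simp [HAlg.lift, coordX, freeX]

@[simp] theorem HAlg.lift_coordY (i : I) : HAlg.lift h z hz (coordY h i) = (z i).2 := by
  simp [HAlg.lift, coordY, freeY]

/-- `H_I` is generated by the coordinates. -/
theorem HAlg.induction {p : HAlg h I → Prop} (alg : ∀ c, p (algebraMap ℂ _ c))
    (x : ∀ i, p (coordX h i)) (y : ∀ i, p (coordY h i)) (add : ∀ a b, p a → p b → p (a + b))
    (mul : ∀ a b, p a → p b → p (a * b)) (a : HAlg h I) : p a := by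
  obtain ⟨a, rfl⟩ := RingQuot.mkAlgHom_surjective ℂ (HRel h I) a
  induction a using FreeAlgebra.induction with
  | grade0 r => simpa using alg r
  | grade1 i => rcases i with i | i; exacts [x i, y i]
  | mul a b ha hb => rw [map_mul]; exact mul _ _ ha hb
  | add a b ha hb => rw [map_add]; exact add _ _ ha hb

theorem HAlg.hom_ext {f g : HAlg h I →ₐ[ℂ] A} (x : ∀ i, f (coordX h i) = g (coordX h i))
    (y : ∀ i, f (coordY h i) = g (coordY h i)) : f = g := by
  refine AlgHom.ext fun a => ?_
  induction a using HAlg.induction with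
  | alg c => simp
  | x i => exact x i
  | y i => exact y i
  | add a b ha hb => simp [ha, hb]
  | mul a b ha hb => simp [ha, hb]

end

/-! ### A representation on functions on `ℤ` -/

/-- Multiplication of functions on `ℤ` by the function `n ↦ h n`, and the two shifts. -/
def weightOp : Module.End ℂ (ℤ → ℂ) where
  toFun f n := h * n * f n
  map_add' f g := by ext n; simp [mul_add]
  map_smul' c f := by ext n; simp; ring

/-- The translation by `m` of functions on `ℤ`. -/
def shiftOp (m : ℤ) : Module.End ℂ (ℤ → ℂ) where
  toFun f n := f (n - m)
  map_add' _ _ := rfl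
  map_smul' _ _ := rfl

/-- The pair of operators with central coordinates `(a, b)`. -/
def opPair (a b : ℂ) : Module.End ℂ (ℤ → ℂ) × Module.End ℂ (ℤ → ℂ) :=
  a • (shiftOp (-1), 0) + b • (weightOp h * shiftOp 1, shiftOp 1)

/-- By bilinearity it suffices to check the two basic pairs against themselves and each other. -/
theorem hPair_opPair (a b a' b' : ℂ) : HPair h (opPair h a b) (opPair h a' b') := by
  have h1 : HPair h (shiftOp (-1), 0) ((shiftOp (-1), 0) : Module.End ℂ (ℤ → ℂ) × _) :=
    HPair.self (by simp)
  have h2 : HPair h (weightOp h * shiftOp 1, shiftOp 1) (weightOp h * shiftOp 1, shiftOp 1) := by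
    refine HPair.self ?_
    ext f n
    simp [weightOp, shiftOp]
    ring
  have h3 : HPair h (shiftOp (-1), 0) (weightOp h * shiftOp 1, shiftOp 1) := by
    refine ⟨?_, ?_, ?_, ?_⟩ <;> refine LinearMap.ext fun f => funext fun n => ?_ <;>
      simp [weightOp, shiftOp]
    ring
  exact (((h1.smul_right a').add_right (h3.smul_right b')).smul_left a).add_left
    (((h3.symm.smul_right a').add_right (h2.smul_right b')).smul_left b)

theorem coordY_ne_zero (i : I) : coordY h i ≠ 0 := by
  intro H
  have := congrArg (HAlg.lift h (fun _ : I => opPair h 0 1) fun _ _ => hPair_opPair h _ _ _ _) H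
  simp only [HAlg.lift_coordY, map_zero] at this
  have := congrFun (congrArg (fun f => f fun _ => 1) this) 0
  simp [opPair, shiftOp] at this

/-- Sending $i$ and $j$ to the two basic points and all other points to zero turns the bracket into
the product of two inverse shifts, that is, the identity operator. -/
theorem br_coord_ne_zero {i j : I} (hij : i ≠ j) :
    br h (coordX h i, coordY h i) (coordX h j, coordY h j) ≠ 0 := by
  intro H
  rw [(HAlg.hPair h i j).br_eq] at H
  classical
  have := congrArg (HAlg.lift h (fun k : I => opPair h (if k = i then 1 else 0)
    (if k = j then 1 else 0)) fun _ _ => hPair_opPair h _ _ _ _) H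
  simp only [HAlg.lift_coordY, HAlg.lift_coordX, map_zero, map_sub, map_mul, if_true, if_neg hij,
    if_neg hij.symm] at this
  have := congrFun (congrArg (fun f => f fun _ => 1) this) 0
  simp [opPair, shiftOp] at this

/-! ### Extension of homomorphisms to right quotient division rings -/

namespace IsRightQuotientDivisionRing

variable {H Q : Type*} [Ring H] [Algebra ℂ H] [DivisionRing Q] [Algebra ℂ Q] {j : H →ₐ[ℂ] Q}

theorem map_ne_zero (hQ : IsRightQuotientDivisionRing j) {a : H} (ha : a ≠ 0) : j a ≠ 0 :=
  (map_ne_zero_iff j hQ.injective).2 ha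

/-- The right Ore condition: write $b^{-1}a\in Q$ as a right quotient $cd^{-1}$ and clear
denominators. -/
theorem exists_ore (hQ : IsRightQuotientDivisionRing j) (a : H) {b : H} (hb : b ≠ 0) :
    ∃ c d, d ≠ 0 ∧ b * c = a * d := by
  obtain ⟨c, d, hd, hq⟩ := hQ.exists_quotient ((j b)⁻¹ * j a)
  refine ⟨c, d, hd, hQ.injective ?_⟩
  have h1 := hQ.map_ne_zero hb
  have h2 := hQ.map_ne_zero hd
  rw [map_mul, map_mul]
  calc j b * j c = j b * (j c * (j d)⁻¹) * j d := by
        rw [← mul_assoc, inv_mul_cancel_right₀ h2]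
    _ = j a * j d := by rw [← hq, mul_inv_cancel_left₀ h1]

theorem mul_inv_mul {D : Type*} [DivisionRing D] (a b : D) {c : D} (hc : c ≠ 0) :
    a * c * (b * c)⁻¹ = a * b⁻¹ := by
  rw [mul_inv_rev, mul_assoc, mul_inv_cancel_left₀ hc]

/-- The Ore relation turns $b^{-1}a'$ into $cd^{-1}$, which merges a product of two right fractions
into one. -/
theorem mul_inv_mul_mul_inv {D : Type*} [DivisionRing D] (a b' : D) {b a' c d : D} (hb : b ≠ 0)
    (hd : d ≠ 0) (h : b * c = a' * d) : a * b⁻¹ * (a' * b'⁻¹) = a * c * (b' * d)⁻¹ := by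
  have h4 : b⁻¹ * a' = c * d⁻¹ := by
    rw [eq_mul_inv_iff_mul_eq₀ hd, mul_assoc, ← h, inv_mul_cancel_left₀ hb]
  rw [mul_inv_rev, mul_assoc, ← mul_assoc b⁻¹, h4]
  simp only [mul_assoc]

/-- An injective homomorphism from `H` to a division ring extends to the right quotient division
ring of `H`. -/
theorem exists_extension (hQ : IsRightQuotientDivisionRing j) {D : Type*} [DivisionRing D]
    [Algebra ℂ D] (ψ : H →ₐ[ℂ] D) (hψ : Function.Injective ψ) :
    ∃ Ψ : Q →ₐ[ℂ] D, ∀ a, Ψ (j a) = ψ a := by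
  have ne : ∀ {a : H}, a ≠ 0 → ψ a ≠ 0 := fun ha => (map_ne_zero_iff ψ hψ).2 ha
  choose num den hden hq using hQ.exists_quotient
  set F : Q → D := fun q => ψ (num q) * (ψ (den q))⁻¹ with hF
  -- The value $\psi(a)\psi(b)^{-1}$ depends only on the fraction: two fractions are compared over a
  -- common denominator $bc=b'd$.
  have of_mul_eq : ∀ {a b a' b' : H}, b ≠ 0 → b' ≠ 0 →
      j a * (j b)⁻¹ = j a' * (j b')⁻¹ → ψ a * (ψ b)⁻¹ = ψ a' * (ψ b')⁻¹ := by
    intro a b a' b' hb hb' hab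
    obtain ⟨c, d, hd, hcd⟩ := hQ.exists_ore b' hb
    have hc : c ≠ 0 := by
      rintro rfl
      have := congrArg j hcd
      simp only [mul_zero, map_zero, map_mul] at this
      exact mul_ne_zero (hQ.map_ne_zero hb') (hQ.map_ne_zero hd) this.symm
    have h1 : a * c = a' * d := by
      apply hQ.injective
      rw [← mul_inv_mul _ _ (hQ.map_ne_zero hc), ← mul_inv_mul (j a') _ (hQ.map_ne_zero hd),
        ← map_mul j b, ← map_mul j b', hcd] at hab
      rw [map_mul, map_mul]
      refine mul_right_cancel₀ (inv_ne_zero ?_) hab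
      rw [map_mul]
      exact mul_ne_zero (hQ.map_ne_zero hb') (hQ.map_ne_zero hd)
    rw [← mul_inv_mul _ _ (ne hc), ← mul_inv_mul (ψ a') _ (ne hd), ← map_mul, ← map_mul,
      ← map_mul, ← map_mul, hcd, h1]
  have F_eq : ∀ {a b : H}, b ≠ 0 → F (j a * (j b)⁻¹) = ψ a * (ψ b)⁻¹ := fun hb =>
    of_mul_eq (hden _) hb (hq _).symm
  have F_j : ∀ a, F (j a) = ψ a := fun a => by
    have h1 : (1 : H) ≠ 0 := fun h => by simpa using congrArg j h
    simpa using F_eq (a := a) h1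
  have F_add : ∀ p q, F (p + q) = F p + F q := by
    intro p q
    obtain ⟨a, b, hb, rfl⟩ := hQ.exists_quotient p
    obtain ⟨a', b', hb', rfl⟩ := hQ.exists_quotient q
    obtain ⟨c, d, hd, hcd⟩ := hQ.exists_ore b' hb
    have hc : c ≠ 0 := by
      rintro rfl
      have := congrArg j hcd
      simp only [mul_zero, map_zero, map_mul] at this
      exact mul_ne_zero (hQ.map_ne_zero hb') (hQ.map_ne_zero hd) this.symm
    have hbc : b * c ≠ 0 := fun h0 => by
      have := congrArg j h0
      rw [map_mul, map_zero] at this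
      exact mul_ne_zero (hQ.map_ne_zero hb) (hQ.map_ne_zero hc) this
    have key : j a * (j b)⁻¹ + j a' * (j b')⁻¹ = j (a * c + a' * d) * (j (b * c))⁻¹ := by
      rw [map_add, add_mul]
      congr 1
      · rw [map_mul, map_mul, mul_inv_mul _ _ (hQ.map_ne_zero hc)]
      · rw [hcd, map_mul, map_mul, mul_inv_mul _ _ (hQ.map_ne_zero hd)]
    rw [key, F_eq hbc, F_eq hb, F_eq hb', map_add, add_mul]
    congr 1
    · rw [map_mul, map_mul, mul_inv_mul _ _ (ne hc)]
    · rw [hcd, map_mul, map_mul, mul_inv_mul _ _ (ne hd)]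
  have F_mul : ∀ p q, F (p * q) = F p * F q := by
    intro p q
    obtain ⟨a, b, hb, rfl⟩ := hQ.exists_quotient p
    obtain ⟨a', b', hb', rfl⟩ := hQ.exists_quotient q
    obtain ⟨c, d, hd, hcd⟩ := hQ.exists_ore a' hb
    have hbd : b' * d ≠ 0 := fun h0 => by
      have := congrArg j h0
      rw [map_mul, map_zero] at this
      exact mul_ne_zero (hQ.map_ne_zero hb') (hQ.map_ne_zero hd) this
    have key : j a * (j b)⁻¹ * (j a' * (j b')⁻¹) = j (a * c) * (j (b' * d))⁻¹ := by
      rw [map_mul, map_mul]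
      exact mul_inv_mul_mul_inv _ _ (hQ.map_ne_zero hb) (hQ.map_ne_zero hd)
        (by rw [← map_mul, hcd, map_mul])
    rw [key, F_eq hbd, F_eq hb, F_eq hb', map_mul, map_mul]
    exact (mul_inv_mul_mul_inv _ _ (ne hb) (ne hd) (by rw [← map_mul, hcd, map_mul])).symm
  exact ⟨{ toFun := F
           map_one' := by simpa using F_j 1
           map_mul' := F_mul
           map_zero' := by simpa using F_j 0
           map_add' := F_add
           commutes' := fun c => by simpa using F_j (algebraMap ℂ H c) }, F_j⟩

end IsRightQuotientDivisionRing

/-! ### Translations of one point -/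

section shift

variable {h : ℂ} {I : Type*} [LinearOrder I] {Q : Type*} [DivisionRing Q] [Algebra ℂ Q]
  {j : HAlg h I →ₐ[ℂ] Q}

/-- The coordinate pair of the point `i` in `H_I`. -/
def coord (h : ℂ) (i : I) : HAlg h I × HAlg h I := (coordX h i, coordY h i)

/-- The translation of the point `i` by a combination of the points `b` and `c`. -/
def shiftHom (h : ℂ) (i b c : I) (s t : ℂ) : HAlg h I →ₐ[ℂ] HAlg h I :=
  HAlg.lift h (fun k => coord h k + if k = i then s • coord h b + t • coord h c else 0) (by
    have H : ∀ k l : I, HPair h (coord h k) (coord h l) := HAlg.hPair h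
    have H0 : ∀ k, HPair h (coord h k) 0 := fun k => by simpa using (H k k).smul_right 0
    have H1 : ∀ k l : I, HPair h (coord h k)
        (if l = i then s • coord h b + t • coord h c else 0) := fun k l => by
      split_ifs
      · exact ((H k b).smul_right s).add_right ((H k c).smul_right t)
      · exact H0 k
    intro k l
    refine ((H k l).add_right (H1 k l)).add_left ?_
    by_cases hk : k = i
    · rw [if_pos hk]
      exact (((H b l).add_right (H1 b l)).smul_left s).add_left
        (((H c l).add_right (H1 c l)).smul_left t)
    · rw [if_neg hk]
      simpa using ((H k l).add_right (H1 k l)).smul_left 0)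

theorem shiftHom_coord_of_ne {i b c k : I} (hk : k ≠ i) (s t : ℂ) :
    shiftHom h i b c s t (coordX h k) = coordX h k ∧
      shiftHom h i b c s t (coordY h k) = coordY h k := by
  simp [shiftHom, hk, coord]

theorem shiftHom_coord_self (i b c : I) (s t : ℂ) :
    shiftHom h i b c s t (coordX h i) = coordX h i + (s • coordX h b + t • coordX h c) ∧
      shiftHom h i b c s t (coordY h i) = coordY h i + (s • coordY h b + t • coordY h c) := by
  simp [shiftHom, coord]

theorem shiftHom_injective {i b c : I} (hb : b ≠ i) (hc : c ≠ i) (s t : ℂ) :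
    Function.Injective (shiftHom h i b c s t) := by
  -- As $b,c\ne i$, both are fixed by the translation, and translating by $(-s,-t)$ undoes it.
  have : (shiftHom h i b c (-s) (-t)).comp (shiftHom h i b c s t) = AlgHom.id ℂ _ := by
    refine HAlg.hom_ext (fun k => ?_) fun k => ?_ <;> rcases eq_or_ne k i with rfl | hk
    · simp only [AlgHom.comp_apply, shiftHom_coord_self, map_add, map_smul,
        shiftHom_coord_of_ne hb, shiftHom_coord_of_ne hc, AlgHom.id_apply]
      module
    · simp [shiftHom_coord_of_ne hk]
    · simp only [AlgHom.comp_apply, shiftHom_coord_self, map_add, map_smul,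
        shiftHom_coord_of_ne hb, shiftHom_coord_of_ne hc, AlgHom.id_apply]
      module
    · simp [shiftHom_coord_of_ne hk]
  exact Function.LeftInverse.injective (g := shiftHom h i b c (-s) (-t)) fun a =>
    DFunLike.congr_fun this a

/-- These endomorphisms provide the genericity of a point: they move the point $i$ and fix
everything generated by the others. The locus where two homomorphisms agree is a skew subfield, so
being fixed need only be checked on generators. -/
theorem exists_shift (hQ : IsRightQuotientDivisionRing j) {i b c : I} (hb : b ≠ i) (hc : c ≠ i)
    (s t : ℂ) : ∃ Ψ : Q →ₐ[ℂ] Q, (∀ q ∈ subQuot j {k | k ≠ i}, Ψ q = q) ∧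
      Ψ (j (coordX h i)) = j (coordX h i) + (s • j (coordX h b) + t • j (coordX h c)) ∧
      Ψ (j (coordY h i)) = j (coordY h i) + (s • j (coordY h b) + t • j (coordY h c)) := by
  obtain ⟨Ψ, hΨ⟩ := hQ.exists_extension (j.comp (shiftHom h i b c s t))
    (hQ.injective.comp (shiftHom_injective hb hc s t))
  refine ⟨Ψ, fun q hq => ?_, ?_, ?_⟩
  · have : subQuot j {k | k ≠ i} ≤ RingHom.eqLocusField (Ψ : Q →+* Q) (RingHom.id Q) := by
      refine Subfield.closure_le.2 ?_
      rintro _ ((⟨c, rfl⟩ | ⟨k, hk, rfl⟩) | ⟨k, hk, rfl⟩)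
      · exact Ψ.commutes c
      · simp [RingHom.eqLocusField, hΨ, shiftHom_coord_of_ne (show k ≠ i from hk)]
      · simp [RingHom.eqLocusField, hΨ, shiftHom_coord_of_ne (show k ≠ i from hk)]
    exact this hq
  · simp [hΨ, shiftHom_coord_self]
  · simp [hΨ, shiftHom_coord_self]

theorem subQuot.coordX_mem {J : Set I} {i : I} (hi : i ∈ J) : j (coordX h i) ∈ subQuot j J :=
  Subfield.subset_closure (Or.inl (Or.inr ⟨i, hi, rfl⟩))

theorem subQuot.coordY_mem {J : Set I} {i : I} (hi : i ∈ J) : j (coordY h i) ∈ subQuot j J :=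
  Subfield.subset_closure (Or.inr ⟨i, hi, rfl⟩)

theorem subQuot.algebraMap_mem (J : Set I) (c : ℂ) : algebraMap ℂ Q c ∈ subQuot j J :=
  Subfield.subset_closure (Or.inl (Or.inl ⟨c, rfl⟩))

/-- `Q_I` is generated by the coordinates as a skew field over `ℂ`. -/
theorem IsRightQuotientDivisionRing.range_le (hQ : IsRightQuotientDivisionRing j) {L : Type*}
    [DivisionRing L] [Algebra ℂ L] (e : Q →ₐ[ℂ] L) (S : Subfield L)
    (alg : ∀ c, algebraMap ℂ L c ∈ S) (x : ∀ i, e (j (coordX h i)) ∈ S)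
    (y : ∀ i, e (j (coordY h i)) ∈ S) (q : Q) : e q ∈ S := by
  have key : ∀ a, e (j a) ∈ S := fun a => by
    induction a using HAlg.induction with
    | alg c => simpa using alg c
    | x i => exact x i
    | y i => exact y i
    | add a b ha hb => simpa using add_mem ha hb
    | mul a b ha hb => simpa using mul_mem ha hb
  obtain ⟨a, b, -, rfl⟩ := hQ.exists_quotient q
  rw [map_mul, map_inv₀]
  exact mul_mem (key a) (inv_mem (key b))

end shift

/-! ### Skew fields and their centers -/

section center

variable {L : Type*} [DivisionRing L]

/-- The elements of the center of `L` that lie in the skew subfield `D`. -/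
def centralPart (D : Subfield L) : Subfield (Subring.center L) :=
  D.comap (Subring.center L).subtype

theorem mem_centralPart {D : Subfield L} {x : Subring.center L} :
    x ∈ centralPart D ↔ (x : L) ∈ D := Iff.rfl

theorem center_comm (x : Subring.center L) (a : L) : a * x = x * a :=
  Subring.mem_center_iff.1 x.2 a

variable {D : Subfield L}
  (hD : ∀ q ∈ D, (∀ a ∈ D, a * q = q * a) → q ∈ Subring.center L)

include hD in
/-- Central elements that are linearly independent over the central part of a skew subfield `D`
are left linearly independent over `D`. -/
theorem linearIndependent_of_centralPart {ι : Type*} {v : ι → Subring.center L}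
    (hv : LinearIndependent (centralPart D) v) : LinearIndependent D fun i => (v i : L) := by
  classical
  rw [linearIndependent_iff]
  intro c
  induction hn : c.support.card using Nat.strong_induction_on generalizing c with
  | _ n ih =>
    intro hc
    by_contra hne
    obtain ⟨i₀, hi₀⟩ := Finsupp.ne_iff.1 hne
    rw [Finsupp.coe_zero, Pi.zero_apply] at hi₀
    -- Shortest-relation argument: with one coefficient normalized to $1$, commuting the relation
    -- with $a\in D$ kills that coefficient. By induction the shorter relation is trivial, so all
    -- coefficients commute with $D$; by `hD` they are central, and the independence over the
    -- central part applies.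
    set c' := (c i₀)⁻¹ • c with hc'
    have hrel : ∑ i ∈ c.support, (c' i : L) * v i = 0 := by
      have : Finsupp.linearCombination D (fun i => (v i : L)) c' = 0 := by
        rw [hc', map_smul, hc, smul_zero]
      rw [Finsupp.linearCombination_apply, Finsupp.sum_of_support_subset _
        (Finsupp.support_smul) _ (by simp)] at this
      exact this
    have h1 : c' i₀ = 1 := by simp [hc', hi₀]
    have hcomm : ∀ a : D, ∀ i, a * c' i = c' i * a := by
      intro a
      set c'' := c'.mapRange (fun q => a * q - q * a) (by simp) with hc''
      have hs : c''.support ⊆ c.support.erase i₀ := by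
        intro i hi
        have hi' := Finsupp.mem_support_iff.1 hi
        refine Finset.mem_erase.2 ⟨?_, ?_⟩
        · rintro rfl
          exact hi' (by simp [hc'', h1])
        · rw [Finsupp.mem_support_iff]
          intro h0
          exact hi' (by simp [hc'', hc', h0])
      have hlt : c''.support.card < n := by
        rw [← hn]
        exact (Finset.card_le_card hs).trans_lt
          (Finset.card_erase_lt_of_mem (Finsupp.mem_support_iff.2 hi₀))
      have h0 := ih _ hlt c'' rfl (by
        rw [Finsupp.linearCombination_apply, Finsupp.sum_of_support_subset _
          (hs.trans (Finset.erase_subset _ _)) _ (by simp)]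
        have : ∀ i, c'' i • (v i : L) = a * ((c' i : L) * v i) - (c' i : L) * v i * a := by
          intro i
          simp only [hc'', Finsupp.mapRange_apply, Subfield.smul_def, smul_eq_mul]
          push_cast
          rw [sub_mul, mul_assoc, mul_assoc, mul_assoc, ← center_comm (v i) (a : L)]
        simp only [this, Finset.sum_sub_distrib, ← Finset.mul_sum, ← Finset.sum_mul, hrel,
          mul_zero, zero_mul, sub_zero])
      intro i
      have := DFunLike.congr_fun h0 i
      simpa [hc'', sub_eq_zero] using this
    have hcen : ∀ i, (c' i : L) ∈ Subring.center L := fun i =>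
      hD _ (c' i).2 fun a ha => congrArg Subtype.val (hcomm ⟨a, ha⟩ i)
    set d : ι → centralPart D := fun i => ⟨⟨c' i, hcen i⟩, (c' i).2⟩
    have := linearIndependent_iff'.1 hv c.support d (by
      apply Subtype.ext
      rw [AddSubmonoidClass.coe_finsetSum, Subring.coe_zero, ← hrel]
      rfl) i₀ (Finsupp.mem_support_iff.2 hi₀)
    have h2 : (c' i₀ : L) = 0 :=
      congrArg (fun x : centralPart D => ((x : Subring.center L) : L)) this
    rw [h1] at h2
    exact one_ne_zero h2

include hD in
/-- A central element that satisfies a monic equation over `D` is algebraic over the central part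
of `D`. -/
theorem isAlgebraic_of_relation {x : Subring.center L} {n : ℕ} {c : Fin n → L}
    (hc : ∀ m, c m ∈ D) (h : (x : L) ^ n + ∑ m : Fin n, c m * (x : L) ^ (m : ℕ) = 0) :
    IsAlgebraic (centralPart D) x := by
  by_contra hx
  -- If `x` were transcendental, its powers would be independent over the central part, hence over
  -- $D$, against the monic relation, whose leading coefficient $1$ is appended by `Fin.snoc`.
  have h1 := linearIndependent_of_centralPart hD (v := fun n : ℕ => x ^ n) (by
    have := (Polynomial.basisMonomials (centralPart D)).linearIndependent.map'
      (Polynomial.aeval x).toLinearMap (LinearMap.ker_eq_bot.2 (transcendental_iff_injective.1 hx))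
    simpa [Function.comp_def, Polynomial.aeval_monomial] using this)
  have h2 := h1.comp (Fin.val : Fin (n + 1) → ℕ) Fin.val_injective
  have h3 := Fintype.linearIndependent_iff.1 h2
    (Fin.snoc (fun m => (⟨c m, hc m⟩ : D)) 1 : Fin (n + 1) → D) (by
      rw [Fin.sum_univ_castSucc]
      simp only [Fin.snoc_castSucc, Fin.snoc_last, Function.comp_apply, one_smul,
        Subfield.smul_def, smul_eq_mul, Fin.val_castSucc, Fin.val_last]
      rw [add_comm]
      exact_mod_cast h) (Fin.last n)
  simp at h3

/-- The elements of the center of `L` that are algebraic over the central part of `D`. -/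
abbrev algPart (D : Subfield L) : IntermediateField (centralPart D) (Subring.center L) :=
  algebraicClosure (centralPart D) (Subring.center L)

variable [Algebra ℂ L]

/-- The elements of `algPart D` are central and closed under products, so their left $D$-span is
already a ring. -/
theorem mem_span_of_mem_adjoin (hC : ∀ c, algebraMap ℂ L c ∈ D) {S : Set L}
    (hS : ∀ σ ∈ S, ∃ x ∈ algPart D, (x : L) = σ) {f : L}
    (hf : f ∈ Algebra.adjoin ℂ ((D : Set L) ∪ S)) :
    f ∈ Submodule.span D (Set.range fun x : algPart D => ((x : Subring.center L) : L)) := by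
  have h1 : ∀ q ∈ D, q ∈ Submodule.span D
      (Set.range fun x : algPart D => ((x : Subring.center L) : L)) := fun q hq => by
    have := Submodule.smul_mem _ (⟨q, hq⟩ : D) (Submodule.subset_span
      (s := Set.range fun x : algPart D => ((x : Subring.center L) : L)) ⟨1, rfl⟩)
    simpa [Subfield.smul_def] using this
  induction hf using Algebra.adjoin_induction with
  | mem f hf =>
    rcases hf with hf | hf
    · exact h1 f hf
    · obtain ⟨x, hx, rfl⟩ := hS f hf
      exact Submodule.subset_span ⟨⟨x, hx⟩, rfl⟩
  | algebraMap c => exact h1 _ (hC c)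
  | add f g _ _ hf hg => exact add_mem hf hg
  | mul f g _ _ hf hg =>
    clear h1
    rename_i hf0 hg0
    clear hf0 hg0
    induction hf using Submodule.span_induction with
    | mem f hf =>
      obtain ⟨x, rfl⟩ := hf
      dsimp only
      induction hg using Submodule.span_induction with
      | mem g hg =>
        obtain ⟨y, rfl⟩ := hg
        exact Submodule.subset_span ⟨x * y, rfl⟩
      | zero => simp
      | add g g' _ _ hg hg' => rw [mul_add]; exact add_mem hg hg'
      | smul q g _ hg =>
        have : (x.1 : L) * (q • g) = q • ((x.1 : L) * g) := by
          rw [Subfield.smul_def, Subfield.smul_def, smul_eq_mul, smul_eq_mul, ← mul_assoc,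
            ← center_comm, mul_assoc]
        rw [this]
        exact Submodule.smul_mem _ _ hg
    | zero => simp
    | add g g' _ _ hg hg' => rw [add_mul]; exact add_mem hg hg'
    | smul q g _ hg =>
      rw [Subfield.smul_def, smul_eq_mul, mul_assoc]
      exact Submodule.smul_mem _ q hg

/-- A basis of the algebraic part over the central part spans the algebra generated by `D` and
algebraic central elements. -/
theorem mem_span_basis (hC : ∀ c, algebraMap ℂ L c ∈ D) {S : Set L}
    (hS : ∀ σ ∈ S, ∃ x ∈ algPart D, (x : L) = σ) {f : L}
    (hf : f ∈ Algebra.adjoin ℂ ((D : Set L) ∪ S)) {ι : Type*}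
    (b : Module.Basis ι (centralPart D) (algPart D)) :
    f ∈ Submodule.span D (Set.range fun i => ((b i : Subring.center L) : L)) := by
  refine Submodule.span_le.2 ?_ (mem_span_of_mem_adjoin hC hS hf)
  rintro _ ⟨x, rfl⟩
  dsimp only
  rw [← b.linearCombination_repr x, Finsupp.linearCombination_apply, Finsupp.sum]
  have : (((∑ i ∈ (b.repr x).support, b.repr x i • b i : algPart D) : Subring.center L) : L)
      = ∑ i ∈ (b.repr x).support, (⟨(b.repr x i : Subring.center L), (b.repr x i).2⟩ : D) •
        ((b i : Subring.center L) : L) := by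
    rw [AddSubmonoidClass.coe_finsetSum, AddSubmonoidClass.coe_finsetSum]
    rfl
  rw [this]
  exact Submodule.sum_mem _ fun i _ => Submodule.smul_mem _ _ (Submodule.subset_span ⟨i, rfl⟩)

include hD in
-- Otherwise `x`, together with a basis of `algPart D`, would be independent over the central part,
-- hence left independent over $D$; but `x` lies in the $D$-span of that basis.
theorem mem_algPart_of_mem_adjoin (hC : ∀ c, algebraMap ℂ L c ∈ D) {S : Set L}
    (hS : ∀ σ ∈ S, ∃ x ∈ algPart D, (x : L) = σ) {x : Subring.center L}
    (hx : (x : L) ∈ Algebra.adjoin ℂ ((D : Set L) ∪ S)) : x ∈ algPart D := by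
  by_contra hx'
  set b := Module.Basis.ofVectorSpace (centralPart D) (algPart D)
  have hb : LinearIndependent (centralPart D) fun i => (b i : Subring.center L) :=
    b.linearIndependent.map' (algPart D).val.toLinearMap
      (LinearMap.ker_eq_bot.2 (algPart D).val.injective)
  have h1 : LinearIndependent (centralPart D)
      (fun o => Option.elim o x fun i => (b i : Subring.center L)) := by
    refine linearIndependent_option.2 ⟨hb, fun hmem => hx' ?_⟩
    refine Submodule.span_le (p := Subalgebra.toSubmodule (algPart D).toSubalgebra).2 ?_ hmem
    rintro _ ⟨i, rfl⟩
    exact (b i).2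
  have h2 := (linearIndependent_of_centralPart hD h1).notMem_span_image (s := Set.range some)
    (x := none) (by simp)
  refine h2 (Submodule.span_mono ?_ (mem_span_basis hC hS hx b))
  rintro _ ⟨i, rfl⟩
  exact ⟨some i, ⟨i, rfl⟩, rfl⟩

include hD in
-- For a basis $b_i$ of `algPart D` over the central part, the products $b_ix$, $b_iy$ are jointly
-- left independent over $D$. The two sides of the equation lie in the spans of the $b_ix$ and of
-- the $b_iy$, which meet only in zero.
theorem eq_zero_of_mul_eq_mul (hC : ∀ c, algebraMap ℂ L c ∈ D) {S : Set L}
    (hS : ∀ σ ∈ S, ∃ x ∈ algPart D, (x : L) = σ) {x y : Subring.center L}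
    (hxy : LinearIndependent (algPart D) ![x, y]) {f g : L}
    (hf : f ∈ Algebra.adjoin ℂ ((D : Set L) ∪ S)) (hg : g ∈ Algebra.adjoin ℂ ((D : Set L) ∪ S))
    (h : x * f = y * g) : f = 0 ∧ g = 0 := by
  set b := Module.Basis.ofVectorSpace (centralPart D) (algPart D)
  have h1 := linearIndependent_of_centralPart hD (linearIndependent_smul b.linearIndependent hxy)
  have key : ∀ (m : Fin 2) {f : L}, f ∈ Algebra.adjoin ℂ ((D : Set L) ∪ S) →
      ((![x, y] m : Subring.center L) : L) * f ∈ Submodule.span D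
        ((fun p : _ × Fin 2 => ((b p.1 • ![x, y] p.2 : Subring.center L) : L)) ''
          {p | p.2 = m}) := by
    intro m f hf
    have := mem_span_basis hC hS hf b
    clear hf
    induction this using Submodule.span_induction with
    | mem f hf =>
      obtain ⟨i, rfl⟩ := hf
      refine Submodule.subset_span ⟨(i, m), rfl, ?_⟩
      exact (center_comm _ _).symm.symm
    | zero => simp
    | add f g _ _ hf hg => rw [mul_add]; exact add_mem hf hg
    | smul q f _ hf =>
      rw [Subfield.smul_def, smul_eq_mul, ← mul_assoc, ← center_comm, mul_assoc]
      exact Submodule.smul_mem _ q hf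
  have h0 : (x : L) * f = 0 := by
    refine Submodule.disjoint_def.1 (h1.disjoint_span_image (s := {p | p.2 = 0})
      (t := {p | p.2 = 1}) ?_) _ (key 0 hf) ?_
    · rw [Set.disjoint_left]
      rintro p (hp : p.2 = 0) (hp' : p.2 = 1)
      rw [hp] at hp'
      exact zero_ne_one hp'
    · rw [h]
      exact key 1 hg
  have hx : (x : L) ≠ 0 := fun h => hxy.ne_zero 0 (Subtype.ext h)
  have hy : (y : L) ≠ 0 := fun h => hxy.ne_zero 1 (Subtype.ext h)
  rw [h0] at h
  exact ⟨(mul_eq_zero.1 h0).resolve_left hx, (mul_eq_zero.1 h.symm).resolve_left hy⟩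

end center

/-! ### Auxiliary facts on brackets, polynomials and centralizers -/

theorem map_br {A B : Type*} [Ring A] [Algebra ℂ A] [Ring B] [Algebra ℂ B] (f : A →ₐ[ℂ] B)
    (h : ℂ) (u v : A × A) : f (br h u v) = br h (f u.1, f u.2) (f v.1, f v.2) := by
  simp [br]

theorem HPair.br_self {A : Type*} [Ring A] [Algebra ℂ A] {h : ℂ} {u : A × A} (H : HPair h u u) :
    br h u u = 0 := by
  rw [H.br_eq, sub_self]

theorem br_add_smul {A : Type*} [Ring A] [Algebra ℂ A] (h : ℂ) (u v w x : A × A) (s t : ℂ) :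
    br h (u + (s • v + t • w)) x = br h u x + (s • br h v x + t • br h w x) := by
  simp only [br, Prod.fst_add, Prod.snd_add, Prod.smul_fst, Prod.smul_snd, add_mul,
    smul_mul_assoc]
  module

/-- The composite of `p` with the affine substitution vanishes on an infinite grid, hence
identically; the substitution is invertible because `c ≠ 0`. -/
theorem eq_zero_of_eval_affine_eq_zero {K : Type*} [Field K] {T : Set K} (hT : T.Infinite)
    {a b c d : K} (hc : c ≠ 0) {p : MvPolynomial (Fin 2) K}
    (hp : ∀ s ∈ T, ∀ t ∈ T, MvPolynomial.eval ![a + t * c, b + s + t * d] p = 0) : p = 0 := by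
  have : Infinite K := hT.to_subtype.of_injective _ Subtype.val_injective
  set R : MvPolynomial (Fin 2) K := MvPolynomial.bind₁
    ![MvPolynomial.C a + MvPolynomial.X 0 * MvPolynomial.C c,
      MvPolynomial.C b + MvPolynomial.X 1 + MvPolynomial.X 0 * MvPolynomial.C d] p with hR
  have hRev : ∀ x : Fin 2 → K, MvPolynomial.eval x R =
      MvPolynomial.eval ![a + x 0 * c, b + x 1 + x 0 * d] p := by
    intro x
    rw [hR, ← MvPolynomial.coe_aeval_eq_eval, ← MvPolynomial.coe_aeval_eq_eval, RingHom.coe_coe,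
      RingHom.coe_coe, MvPolynomial.aeval_bind₁]
    congr 2
    ext k
    fin_cases k <;> simp
  have hR0 : R = 0 := by
    refine MvPolynomial.funext_set (fun _ => T) (fun _ => hT) fun x hx => ?_
    rw [hRev, map_zero]
    exact hp _ (hx 1 trivial) _ (hx 0 trivial)
  refine MvPolynomial.funext fun x => ?_
  have h1 := hRev ![(x 0 - a) / c, x 1 - b - (x 0 - a) / c * d]
  rw [hR0, map_zero] at h1
  rw [map_zero, h1]
  congr 2
  ext k
  fin_cases k
  · simp [div_mul_cancel₀ _ hc]
  · simp only [Fin.mk_one, Matrix.cons_val_zero, Matrix.cons_val_one]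
    ring

section center

variable (L : Type*) [DivisionRing L] [Algebra ℂ L]

/-- The complex numbers as elements of the center. -/
def centerMap : ℂ →+* Subring.center L :=
  (algebraMap ℂ L).codRestrict _ fun c => Subring.mem_center_iff.2 fun a =>
    (Algebra.commutes c a).symm

theorem charZero_center : CharZero (Subring.center L) :=
  charZero_of_injective_ringHom (centerMap L).injective

/-- The centralizer of an element, as a skew subfield. -/
def centralizerSubfield {L : Type*} [DivisionRing L] (x : L) : Subfield L where
  __ := Subring.centralizer {x}
  inv_mem' a ha := by
    have ha' : x * a = a * x := Subring.mem_centralizer_iff.1 ha x rfl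
    exact Subring.mem_centralizer_iff.2 fun y hy => by
      rw [Set.mem_singleton_iff.1 hy]
      exact Commute.inv_right₀ ha'

theorem mem_centralizerSubfield {L : Type*} [DivisionRing L] {x a : L} :
    a ∈ centralizerSubfield x ↔ x * a = a * x :=
  ⟨fun h => Subring.mem_centralizer_iff.1 h x rfl, fun h => Subring.mem_centralizer_iff.2
    fun y hy => by rw [Set.mem_singleton_iff.1 hy]; exact h⟩

end center

/-! ### Coordinates in `L` and algebraic independence -/

section coords

variable {h : ℂ} {I : Type*} [LinearOrder I] {Q : Type*} [DivisionRing Q] [Algebra ℂ Q]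
  {j : HAlg h I →ₐ[ℂ] Q} {L : Type*} [DivisionRing L] [Algebra ℂ L] (e : Q →ₐ[ℂ] L)
  {z : I → L × L} (hz : ∀ i, z i = (e (j (coordX h i)), e (j (coordY h i))))

include hz

theorem hPair_coords (i k : I) : HPair h (z i) (z k) := by
  rw [hz, hz]
  exact ((HAlg.hPair h i k).map j).map e

theorem coords_snd_ne_zero (hQ : IsRightQuotientDivisionRing j) (i : I) : (z i).2 ≠ 0 := by
  rw [hz]
  exact (map_ne_zero e).2 (hQ.map_ne_zero (coordY_ne_zero h i))

theorem coords_br_ne_zero (hQ : IsRightQuotientDivisionRing j) {i k : I} (hik : i ≠ k) :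
    br h (z i) (z k) ≠ 0 := by
  rw [hz, hz]
  have := (map_ne_zero e).2 (hQ.map_ne_zero (br_coord_ne_zero h hik))
  rwa [map_br, map_br] at this

/-- Induction over `L`, if it is generated by the coordinates and a set `T`. -/
theorem mem_subfield_of_generators (hQ : IsRightQuotientDivisionRing j) {T : Set L}
    (hL : Algebra.adjoin ℂ (Set.range e ∪ T) = ⊤) (F : Subfield L)
    (alg : ∀ c, algebraMap ℂ L c ∈ F) (x : ∀ i, (z i).1 ∈ F) (y : ∀ i, (z i).2 ∈ F)
    (hT : ∀ t ∈ T, t ∈ F) (a : L) : a ∈ F := by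
  have ha : a ∈ Algebra.adjoin ℂ (Set.range e ∪ T) := hL ▸ Algebra.mem_top
  have hq : ∀ q, e q ∈ F :=
    hQ.range_le e _ alg (fun i => by simpa [hz] using x i) fun i => by simpa [hz] using y i
  induction ha using Algebra.adjoin_induction with
  | mem a ha =>
    rcases ha with ⟨q, rfl⟩ | ha
    · exact hq q
    · exact hT a ha
  | algebraMap c => exact alg c
  | add a b _ _ ha hb => exact add_mem ha hb
  | mul a b _ _ ha hb => exact mul_mem ha hb

/-- Elements of `L` that commute with the coordinates are central, if `L` is generated by the
coordinates and by central elements. -/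
theorem mem_center_of_commute (hQ : IsRightQuotientDivisionRing j) {T : Set L}
    (hT : ∀ t ∈ T, ∀ a, t * a = a * t) (hL : Algebra.adjoin ℂ (Set.range e ∪ T) = ⊤) {x : L}
    (hx : ∀ i, x * (z i).1 = (z i).1 * x) (hy : ∀ i, x * (z i).2 = (z i).2 * x) :
    x ∈ Subring.center L :=
  Subring.mem_center_iff.2 fun a => (mem_centralizerSubfield.1 (mem_subfield_of_generators e hz hQ
    hL (centralizerSubfield x) (fun c => mem_centralizerSubfield.2 (Algebra.commutes c x).symm)
    (fun i => mem_centralizerSubfield.2 (hx i)) (fun i => mem_centralizerSubfield.2 (hy i))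
    (fun t ht => mem_centralizerSubfield.2 (hT t ht x).symm) a)).symm

variable {b : I} {A B : I → Subring.center L} (hA : ∀ i, (A i : L) = br h (z i) (z b))
  (hB : ∀ i, (B i : L) = (z i).2 * ((z b).2)⁻¹)

include hA hB

/-- Translating the point $i$ by $s\,b+t\,c$ fixes the coefficients of the relation. It moves $A_i$
to $A_i+tA_c$, because $(bb)=0$, and $B_i$ to $B_i+s+tB_c$. -/
theorem eval_shift_eq_zero (hQ : IsRightQuotientDivisionRing j) {i c : I} (hb : b ≠ i)
    (hc : c ≠ i)
    {p : MvPolynomial (Fin 2) (centralPart ((subQuot j {k | k ≠ i}).map (e : Q →+* L)))}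
    (hp : MvPolynomial.aeval ![A i, B i] p = 0) (s t : ℂ) :
    MvPolynomial.aeval ![A i + centerMap L t * A c, B i + centerMap L s + centerMap L t * B c] p
      = 0 := by
  obtain ⟨Ψ, hΨ, hΨx, hΨy⟩ := exists_shift hQ hb hc s t
  set zQ : I → Q × Q := fun i => (j (coordX h i), j (coordY h i))
  set a : I → Q := fun i => br h (zQ i) (zQ b)
  set β : I → Q := fun i => (zQ i).2 * ((zQ b).2)⁻¹
  have hzb : j (coordY h b) ≠ 0 := hQ.map_ne_zero (coordY_ne_zero h b)
  have ha : ∀ i, e (a i) = A i := fun i => by rw [hA, map_br, hz, hz]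
  have hβ : ∀ i, e (β i) = B i := fun i => by simp [hB, hz, β, zQ]
  have hΨb : Ψ (zQ b).1 = (zQ b).1 ∧ Ψ (zQ b).2 = (zQ b).2 :=
    ⟨hΨ _ (subQuot.coordX_mem hb), hΨ _ (subQuot.coordY_mem hb)⟩
  have hΨa : Ψ (a i) = a i + t • a c := by
    have : Ψ (a i) = br h (zQ i + (s • zQ b + t • zQ c)) (zQ b) := by
      rw [map_br, hΨb.1, hΨb.2]
      congr 1
      exact Prod.ext hΨx hΨy
    rw [this, br_add_smul, ((HAlg.hPair h b b).map j).br_self, smul_zero, zero_add]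
  have hΨβ : Ψ (β i) = β i + algebraMap ℂ Q s + t • β c := by
    simp only [β, map_mul, map_inv₀, hΨb.2]
    rw [show Ψ (zQ i).2 = (zQ i).2 + (s • (zQ b).2 + t • (zQ c).2) from hΨy]
    rw [add_mul, add_mul, smul_mul_assoc, smul_mul_assoc, mul_inv_cancel₀ hzb,
      Algebra.algebraMap_eq_smul_one, add_assoc]
  have hcoef : ∀ d, ∃ q ∈ subQuot j {k | k ≠ i},
      e q = (((p.coeff d : centralPart ((subQuot j {k | k ≠ i}).map (e : Q →+* L))) :
        Subring.center L) : L) := fun d => (p.coeff d).2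
  choose q hq hqe using hcoef
  rw [MvPolynomial.aeval_def, MvPolynomial.eval₂_eq'] at hp ⊢
  simp only [Fin.prod_univ_two] at hp ⊢
  -- The translation acts on `Q` and is not extended to `L`, so the relation is first pulled back
  -- along the injective map `e`.
  have h0 : ∑ d ∈ p.support, q d * (a i ^ d 0 * β i ^ d 1) = 0 := by
    apply (map_eq_zero e).1
    rw [map_sum]
    have := congrArg Subtype.val hp
    rw [AddSubmonoidClass.coe_finsetSum] at this
    refine (Finset.sum_congr rfl fun d _ => ?_).trans this
    rw [map_mul, map_mul, map_pow, map_pow, ha, hβ, hqe]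
    rfl
  have h1 := congrArg (fun q => e (Ψ q)) h0
  simp only [map_sum, map_zero, map_mul, map_pow, hΨ _ (hq _), hΨa, hΨβ, map_add, map_smul, ha,
    hβ, hqe, AlgHom.commutes] at h1
  apply Subtype.ext
  rw [AddSubmonoidClass.coe_finsetSum]
  refine (Finset.sum_congr rfl fun d _ => ?_).trans h1
  simp only [Algebra.smul_def]
  rfl

/-- The coordinates of the point `i` are algebraically independent over the central elements that
come from the other points. -/
theorem algebraicIndependent_coords (hQ : IsRightQuotientDivisionRing j) {i c : I} (hb : b ≠ i)
    (hc : c ≠ i) (hcb : c ≠ b) :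
    AlgebraicIndependent (centralPart ((subQuot j {k | k ≠ i}).map (e : Q →+* L)))
      ![A i, B i] := by
  have hAc : A c ≠ 0 := fun h0 => coords_br_ne_zero e hz hQ hcb (by rw [← hA, h0]; rfl)
  have := charZero_center L
  rw [algebraicIndependent_iff]
  intro p hp
  refine MvPolynomial.map_injective _ (algebraMap _ (Subring.center L)).injective ?_
  rw [map_zero]
  -- The complex parameters $s,t$ run over an infinite grid, and $A_c\ne0$ makes the substitution
  -- invertible.
  refine eq_zero_of_eval_affine_eq_zero (Set.infinite_range_of_injective (centerMap L).injective)
    hAc (a := A i) (b := B i) (d := B c) ?_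
  rintro _ ⟨s, rfl⟩ _ ⟨t, rfl⟩
  rw [MvPolynomial.eval_map, ← MvPolynomial.aeval_def]
  exact eval_shift_eq_zero e hz hA hB hQ hb hc hp s t

end coords

/-! ### Points with central coordinates -/

section point

variable {L : Type*} [DivisionRing L] [Algebra ℂ L] {h : ℂ}

omit [Algebra ℂ L] in
theorem center_smul_eq (c : Subring.center L) (x : L) : c • x = (c : L) * x := rfl

theorem smul_center_smul (r : ℂ) (c : Subring.center L) (x : L) : r • c • x = c • r • x := by
  rw [center_smul_eq, center_smul_eq, mul_smul_comm]

/-- The point with central coordinates `p` with respect to the base point `w`. -/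
def pt (w : L × L) (p : Subring.center L × Subring.center L) : L × L :=
  (p.1 • w.2⁻¹ + p.2 • (w.1 * w.2⁻¹ * w.2), p.2 • w.2)

/-- The determinant of two vectors. -/
def det₂ {R : Type*} [CommRing R] (p q : R × R) : R := p.1 * q.2 - p.2 * q.1

theorem base_comm {w : L × L} (hw : HPair h w w) (h0 : w.2 ≠ 0) :
    w.1 * w.2⁻¹ * w.2 = w.2 * (w.1 * w.2⁻¹) + h • w.2 := by
  rw [inv_mul_cancel_right₀ h0, ← mul_assoc]
  have := hw.yx
  rw [this, sub_mul, mul_inv_cancel_right₀ h0, smul_mul_assoc, mul_inv_cancel_right₀ h0]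
  abel

/-- Only `base_comm`, the relation between $u=x_by_b^{-1}$ and $y_b$, is noncommutative here. Its
correction in the coefficient of `p.2 * q.2` cancels the term $-hYY'$ of the bracket. -/
theorem br_pt {w : L × L} (hw : HPair h w w) (h0 : w.2 ≠ 0)
    (p q : Subring.center L × Subring.center L) :
    br h (pt w p) (pt w q) = ((det₂ p q : Subring.center L) : L) := by
  have h1 := base_comm hw h0
  simp only [br, pt]
  generalize w.1 * w.2⁻¹ = u at h1 ⊢
  have e : ((det₂ p q : Subring.center L) : L) = (p.1 * q.2 - p.2 * q.1) • (1 : L) := by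
    rw [center_smul_eq, mul_one]; rfl
  rw [e]
  simp only [smul_mul_assoc, mul_smul_comm, smul_smul, add_mul, mul_add, smul_add,
    inv_mul_cancel₀ h0, mul_inv_cancel₀ h0, smul_center_smul, sub_smul, ← mul_assoc]
  have h2 : u * w.2 * w.2 = w.2 * u * w.2 + h • (w.2 * w.2) := by
    rw [h1, add_mul, smul_mul_assoc]
  rw [h2, mul_comm q.2 p.1, mul_comm q.1, mul_comm q.2 p.2, smul_add]
  abel

/-- The correction from moving `w.2⁻¹` past `t.1` is opposite to the one from moving `v.2` past
`t.1`. -/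
theorem HPair.central_snd {w v t : L × L} (h0 : w.2 ≠ 0)
    (hwt : HPair h w t) (hvt : HPair h v t) :
    v.2 * w.2⁻¹ * t.1 = t.1 * (v.2 * w.2⁻¹) ∧ v.2 * w.2⁻¹ * t.2 = t.2 * (v.2 * w.2⁻¹) := by
  have e1 : t.2 * w.2⁻¹ = w.2⁻¹ * t.2 := by
    rw [mul_inv_eq_iff_eq_mul₀ h0, mul_assoc, hwt.yy, inv_mul_cancel_left₀ h0]
  have e2 : w.2⁻¹ * t.1 = t.1 * w.2⁻¹ + h • (t.2 * w.2⁻¹) := by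
    rw [inv_mul_eq_iff_eq_mul₀ h0, mul_add, ← mul_assoc, mul_smul_comm, ← mul_assoc,
      ← hwt.yy, mul_inv_cancel_right₀ h0, hwt.symm.yx, sub_mul, mul_inv_cancel_right₀ h0,
      smul_mul_assoc, mul_inv_cancel_right₀ h0, sub_add_cancel]
  constructor
  · rw [mul_assoc, e2, mul_add, ← mul_assoc, hvt.symm.yx, mul_smul_comm, sub_mul, smul_mul_assoc,
      ← mul_assoc, hvt.symm.yy, mul_assoc t.1, sub_add_cancel]
  · rw [mul_assoc, ← e1, ← mul_assoc, ← hvt.yy, mul_assoc]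

/-- A coordinate pair is recovered from its central coordinates. -/
theorem HPair.pt_eq {w v : L × L} (h0 : w.2 ≠ 0) (hwv : HPair h w v)
    {a c : Subring.center L} (ha : (a : L) = br h v w) (hc : (c : L) = v.2 * w.2⁻¹) :
    v = pt w (a, c) := by
  refine Prod.ext ?_ ?_
  · simp only [pt, center_smul_eq, ha, hwv.symm.br_eq]
    rw [← center_comm, hc, inv_mul_cancel_right₀ h0, sub_mul, mul_inv_cancel_right₀ h0, mul_assoc,
      sub_add_cancel]
  · simp only [pt, center_smul_eq, hc, inv_mul_cancel_right₀ h0]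

end point

/-! ### Central coordinates and central linear forms -/

section coords

variable {h : ℂ} {I : Type*} [LinearOrder I] {Q : Type*} [DivisionRing Q] [Algebra ℂ Q]
  {j : HAlg h I →ₐ[ℂ] Q} {L : Type*} [DivisionRing L] [Algebra ℂ L] (e : Q →ₐ[ℂ] L)
  {z : I → L × L} (hz : ∀ i, z i = (e (j (coordX h i)), e (j (coordY h i))))
  (hQ : IsRightQuotientDivisionRing j) {T : Set L} (hT : ∀ t ∈ T, ∀ a, t * a = a * t)
  (hL : Algebra.adjoin ℂ (Set.range e ∪ T) = ⊤)

include hz hQ hT hL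

theorem exists_central_coords (b : I) : ∃ A B : I → Subring.center L,
    (∀ i, (A i : L) = br h (z i) (z b)) ∧ ∀ i, (B i : L) = (z i).2 * ((z b).2)⁻¹ := by
  have hp := hPair_coords e hz
  have h0 := coords_snd_ne_zero e hz hQ b
  refine ⟨fun i =>
      ⟨br h (z i) (z b), mem_center_of_commute e hz hQ hT hL (fun k => ?_) fun k => ?_⟩,
    fun i => ⟨(z i).2 * ((z b).2)⁻¹, mem_center_of_commute e hz hQ hT hL (fun k => ?_) fun k => ?_⟩,
    fun i => rfl, fun i => rfl⟩
  · exact ((hp i b).commute_br_fst (hp i k) (hp b k)).eq.symm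
  · exact ((hp i b).commute_br_snd (hp i k) (hp b k)).eq.symm
  · exact (HPair.central_snd h0 (hp b k) (hp i k)).1
  · exact (HPair.central_snd h0 (hp b k) (hp i k)).2

variable {b : I} {A B : I → Subring.center L} (hA : ∀ i, (A i : L) = br h (z i) (z b))
  (hB : ∀ i, (B i : L) = (z i).2 * ((z b).2)⁻¹)

include hA hB

/-- The pair `z o` is built from the base pair and central coordinates, so commuting with the image
of $Q_{I\setminus\{o\}}$ already implies commuting with `z o`. In particular the center of that
image lies in the center of $L$. -/
theorem mem_center_of_commute_sub {o : I} (hb : b ≠ o) {x : L}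
    (hx : ∀ a ∈ (subQuot j {k | k ≠ o}).map (e : Q →+* L), a * x = x * a) :
    x ∈ Subring.center L := by
  have h0 := coords_snd_ne_zero e hz hQ b
  have hD : ∀ k, k ≠ o → (z k).1 ∈ (subQuot j {k | k ≠ o}).map (e : Q →+* L) ∧
      (z k).2 ∈ (subQuot j {k | k ≠ o}).map (e : Q →+* L) := fun k hk => by
    rw [hz]
    exact ⟨⟨_, subQuot.coordX_mem hk, rfl⟩, ⟨_, subQuot.coordY_mem hk, rfl⟩⟩
  have hcomm : ∀ k, x * (z k).1 = (z k).1 * x ∧ x * (z k).2 = (z k).2 * x := by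
    intro k
    rcases eq_or_ne k o with rfl | hk
    · have hk := (hPair_coords e hz b k).pt_eq h0 (hA k) (hB k)
      have h1 := hx _ (hD b hb).2
      have h2 := hx _ (inv_mem (hD b hb).2)
      have h3 := hx _ (mul_mem (mul_mem (hD b hb).1 (inv_mem (hD b hb).2)) (hD b hb).2)
      rw [hk]
      simp only [pt, mul_add, add_mul, mul_smul_comm, smul_mul_assoc, h1, h2, h3, and_self]
    · exact ⟨(hx _ (hD k hk).1).symm, (hx _ (hD k hk).2).symm⟩
  exact mem_center_of_commute e hz hQ hT hL (fun k => (hcomm k).1) fun k => (hcomm k).2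

/-- With $\xi=\eta(X-uY)$ and $\upsilon=\eta^{-1}Y$ the form is $A_o\upsilon-B_o\xi$. Commuting it
with $a\in D$ gives $A_o[a,\upsilon]=B_o[a,\xi]$. Since $A_o,B_o$ are linearly independent over
`algPart D`, both commutators vanish, so $\xi$ and $\upsilon$ are central; lying in $D[S]$, they are
algebraic. -/
theorem exists_central_point {o c : I} (hb : b ≠ o) (hc : c ≠ o) (hcb : c ≠ b) {S : Set L}
    (hS : ∀ σ ∈ S, ∃ x ∈ algPart ((subQuot j {k | k ≠ o}).map (e : Q →+* L)), (x : L) = σ)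
    {X Y : L}
    (hX : X ∈ Algebra.adjoin ℂ (((subQuot j {k | k ≠ o}).map (e : Q →+* L) : Set L) ∪ S))
    (hY : Y ∈ Algebra.adjoin ℂ (((subQuot j {k | k ≠ o}).map (e : Q →+* L) : Set L) ∪ S))
    (hXY : ∀ a, br h (z o) (X, Y) * a = a * br h (z o) (X, Y)) :
    ∃ p : Subring.center L × Subring.center L, (X, Y) = pt (z b) p ∧
      p.1 ∈ algPart ((subQuot j {k | k ≠ o}).map (e : Q →+* L)) ∧
      p.2 ∈ algPart ((subQuot j {k | k ≠ o}).map (e : Q →+* L)) := by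
  set D := (subQuot j {k | k ≠ o}).map (e : Q →+* L)
  have h0 := coords_snd_ne_zero e hz hQ b
  have hDc : ∀ q ∈ D, (∀ a ∈ D, a * q = q * a) → q ∈ Subring.center L := fun q _ hq =>
    mem_center_of_commute_sub e hz hQ hT hL hA hB hb hq
  have hC : ∀ c, algebraMap ℂ L c ∈ D := fun c => ⟨_, subQuot.algebraMap_mem _ c, by simp⟩
  have hzb : (z b).1 ∈ D ∧ (z b).2 ∈ D := by
    rw [hz]
    exact ⟨⟨_, subQuot.coordX_mem hb, rfl⟩, ⟨_, subQuot.coordY_mem hb, rfl⟩⟩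
  set η := (z b).2 with hη
  set u := (z b).1 * η⁻¹ with hu
  set F := Algebra.adjoin ℂ ((D : Set L) ∪ S)
  have hDF : ∀ a ∈ D, a ∈ F := fun a ha => Algebra.subset_adjoin (Or.inl ha)
  have hli :=
    (algebraicIndependent_coords e hz hA hB hQ hb hc hcb).algebraicClosure.linearIndependent
  -- These invert the formula for `pt`, with the factor $\eta^{\pm1}$ kept on the left because
  -- centrality is not yet known.
  set υ := η⁻¹ * Y with hυ
  set ξ := η * (X - u * Y) with hξ
  have hυF : υ ∈ F := mul_mem (hDF _ (inv_mem hzb.2)) hY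
  have hξF : ξ ∈ F := mul_mem (hDF _ hzb.2)
    (sub_mem hX (mul_mem (hDF _ (mul_mem hzb.1 (inv_mem hzb.2))) hY))
  have hbr : br h (z o) (X, Y) = A o * υ - B o * ξ := by
    rw [(hPair_coords e hz b o).pt_eq h0 (hA o) (hB o)]
    have h1 : u * η = η * u + h • η := base_comm (hPair_coords e hz b b) h0
    simp only [br, pt, ← hη, ← hu, h1, hυ, hξ, center_smul_eq, add_mul, mul_add, mul_sub,
      smul_mul_assoc,
      mul_smul_comm, mul_assoc]
    abel
  have hcomm : ∀ a ∈ D, a * υ = υ * a ∧ a * ξ = ξ * a := by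
    intro a ha
    have h1 := hXY a
    have h2 : (A o : L) * (a * υ - υ * a) = B o * (a * ξ - ξ * a) := by
      rw [hbr] at h1
      have h3 : a * (A o * υ - B o * ξ) = A o * (a * υ) - B o * (a * ξ) := by
        have h4 (x : Subring.center L) (y : L) : a * (x * y) = x * (a * y) := by
          rw [← mul_assoc, center_comm, mul_assoc]
        rw [mul_sub, h4, h4]
      rw [h3, sub_mul, mul_assoc _ υ, mul_assoc _ ξ] at h1
      rw [mul_sub, mul_sub]
      rw [sub_eq_sub_iff_add_eq_add] at h1 ⊢
      rw [← h1, add_comm]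
    have h3 := eq_zero_of_mul_eq_mul hDc hC hS hli
      (sub_mem (mul_mem (hDF a ha) hυF) (mul_mem hυF (hDF a ha)))
      (sub_mem (mul_mem (hDF a ha) hξF) (mul_mem hξF (hDF a ha))) h2
    exact ⟨sub_eq_zero.1 h3.1, sub_eq_zero.1 h3.2⟩
  have hυc : υ ∈ Subring.center L :=
    mem_center_of_commute_sub e hz hQ hT hL hA hB hb fun a ha => (hcomm a ha).1
  have hξc : ξ ∈ Subring.center L :=
    mem_center_of_commute_sub e hz hQ hT hL hA hB hb fun a ha => (hcomm a ha).2
  refine ⟨(⟨ξ, hξc⟩, ⟨υ, hυc⟩), ?_, mem_algPart_of_mem_adjoin hDc hC hS hξF,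
    mem_algPart_of_mem_adjoin hDc hC hS hυF⟩
  have hY' : Y = υ * η := by
    rw [← Subring.mem_center_iff.1 hυc, hυ, mul_inv_cancel_left₀ h0]
  have hX' : X = ξ * η⁻¹ + υ * (u * η) := by
    have h5 : υ * (u * η) = u * Y := by
      rw [← mul_assoc, ← Subring.mem_center_iff.1 hυc, mul_assoc, ← hY']
    rw [h5, ← Subring.mem_center_iff.1 hξc, hξ, inv_mul_cancel_left₀ h0, sub_add_cancel]
  exact Prod.ext hX' hY'

end coords

/-! ### Bimodules -/

section bimodule

variable {L M : Type*} [Ring L] [Algebra ℂ L] [AddCommGroup M] [Module (Env L) M]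

theorem envMk_mul (a b c d : L) : envMk a b * envMk c d = envMk (a * c) (d * b) :=
  Algebra.TensorProduct.tmul_mul_tmul a c (MulOpposite.op b) (MulOpposite.op d)

theorem envMk_one : envMk (1 : L) 1 = 1 := rfl

theorem envMk_add_left (a b c : L) : envMk (a + b) c = envMk a c + envMk b c :=
  TensorProduct.add_tmul _ _ _

theorem envMk_add_right (a b c : L) : envMk a (b + c) = envMk a b + envMk a c :=
  TensorProduct.tmul_add _ _ _

theorem envMk_smul_left (r : ℂ) (a b : L) : envMk (r • a) b = r • envMk a b := rfl

theorem envMk_smul_right (r : ℂ) (a b : L) : envMk a (r • b) = r • envMk a b :=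
  TensorProduct.tmul_smul r a (MulOpposite.op b)

theorem lact_lact (a b : L) (m : M) : lact a (lact b m) = lact (a * b) m := by
  rw [lact, lact, lact, smul_smul, envMk_mul, one_mul]

theorem ract_ract (a b : L) (m : M) : ract (ract m a) b = ract m (a * b) := by
  rw [ract, ract, ract, smul_smul, envMk_mul, one_mul]

theorem lact_ract (a b : L) (m : M) : lact a (ract m b) = ract (lact a m) b := by
  rw [ract, lact, lact, ract, smul_smul, smul_smul, envMk_mul, envMk_mul, one_mul, mul_one,
    one_mul, mul_one]

theorem lact_add (a : L) (m n : M) : lact a (m + n) = lact a m + lact a n := smul_add _ _ _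

theorem lact_sub (a : L) (m n : M) : lact a (m - n) = lact a m - lact a n := smul_sub _ _ _

theorem lact_neg (a : L) (m : M) : lact a (-m) = -lact a m := smul_neg _ _

theorem lact_zero (a : L) : lact a (0 : M) = 0 := smul_zero _

theorem ract_add (a : L) (m n : M) : ract (m + n) a = ract m a + ract n a := smul_add _ _ _

theorem ract_sub (a : L) (m n : M) : ract (m - n) a = ract m a - ract n a := smul_sub _ _ _

theorem ract_neg (a : L) (m : M) : ract (-m) a = -ract m a := smul_neg _ _

theorem ract_zero (a : L) : ract (0 : M) a = 0 := smul_zero _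

theorem lact_one (m : M) : lact (1 : L) m = m := by rw [lact, envMk_one, one_smul]

theorem ract_one (m : M) : ract m (1 : L) = m := by rw [ract, envMk_one, one_smul]

theorem lact_add_left (a b : L) (m : M) : lact (a + b) m = lact a m + lact b m := by
  rw [lact, envMk_add_left, add_smul]; rfl

theorem ract_add_right (a b : L) (m : M) : ract m (a + b) = ract m a + ract m b := by
  rw [ract, envMk_add_right, add_smul]; rfl

theorem lact_zero_left (m : M) : lact (0 : L) m = 0 := by
  have := lact_add_left (0 : L) 0 m
  rwa [add_zero, left_eq_add] at this

theorem ract_zero_right (m : M) : ract m (0 : L) = 0 := by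
  have := ract_add_right (0 : L) 0 m
  rwa [add_zero, left_eq_add] at this

theorem lact_neg_left (a : L) (m : M) : lact (-a) m = -lact a m := by
  have := lact_add_left a (-a) m
  rw [add_neg_cancel, lact_zero_left] at this
  exact (neg_eq_of_add_eq_zero_right this.symm).symm

theorem ract_neg_right (a : L) (m : M) : ract m (-a) = -ract m a := by
  have := ract_add_right a (-a) m
  rw [add_neg_cancel, ract_zero_right] at this
  exact (neg_eq_of_add_eq_zero_right this.symm).symm

theorem lact_sub_left (a b : L) (m : M) : lact (a - b) m = lact a m - lact b m := by
  rw [sub_eq_add_neg, lact_add_left, lact_neg_left, sub_eq_add_neg]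

variable [Module ℂ M] [IsScalarTower ℂ (Env L) M]

theorem ract_smul_right (r : ℂ) (a : L) (m : M) : ract m (r • a) = r • ract m a := by
  rw [ract, envMk_smul_right, smul_assoc]; rfl

theorem lact_smul_left (r : ℂ) (a : L) (m : M) : lact (r • a) m = r • lact a m := by
  rw [lact, envMk_smul_left, smul_assoc]; rfl

theorem smul_eq_lact (r : ℂ) (m : M) : r • m = lact (algebraMap ℂ L r) m := by
  rw [Algebra.algebraMap_eq_smul_one, lact_smul_left, lact_one]

theorem smul_eq_ract (r : ℂ) (m : M) : r • m = ract m (algebraMap ℂ L r) := by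
  rw [Algebra.algebraMap_eq_smul_one, ract_smul_right, ract_one]

theorem ract_smul (r : ℂ) (a : L) (m : M) : ract (r • m) a = r • ract m a := by
  rw [smul_eq_ract (L := L), ract_ract, Algebra.commutes, ← ract_ract, ← smul_eq_ract]

end bimodule

/-- The elements of a skew field that commute with an element of a bimodule. -/
def commutant {L M : Type*} [DivisionRing L] [Algebra ℂ L] [AddCommGroup M] [Module (Env L) M]
    (m : M) : Subfield L where
  carrier := {a | lact a m = ract m a}
  mul_mem' {a b} ha hb := by
    change lact _ _ = ract _ _
    rw [← lact_lact, show lact b m = ract m b from hb, lact_ract, show lact a m = ract m a from ha,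
      ract_ract]
  one_mem' := by change lact _ _ = ract _ _; rw [lact_one, ract_one]
  add_mem' {a b} ha hb := by
    change lact _ _ = ract _ _
    rw [lact_add_left, ract_add_right, show lact b m = ract m b from hb,
      show lact a m = ract m a from ha]
  zero_mem' := by change lact _ _ = ract _ _; rw [lact_zero_left, ract_zero_right]
  neg_mem' {a} ha := by
    change lact _ _ = ract _ _
    rw [lact_neg_left, ract_neg_right, show lact a m = ract m a from ha]
  inv_mem' a ha := by
    change lact _ _ = ract _ _
    rcases eq_or_ne a 0 with rfl | h0
    · rw [inv_zero, lact_zero_left, ract_zero_right]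
    have h1 : lact a⁻¹ (ract (lact a m) a⁻¹) = lact a⁻¹ (ract (ract m a) a⁻¹) := by
      rw [show lact a m = ract m a from ha]
    rwa [ract_ract, mul_inv_cancel₀ h0, ract_one, ← lact_ract, lact_lact, inv_mul_cancel₀ h0,
      lact_one, eq_comm] at h1

theorem mem_commutant {L M : Type*} [DivisionRing L] [Algebra ℂ L] [AddCommGroup M]
    [Module (Env L) M] {m : M} {a : L} : a ∈ commutant m ↔ lact a m = ract m a := Iff.rfl

/-! ### The differential module -/

section diff

variable {I L : Type*} [DivisionRing L] [Algebra ℂ L] {h : ℂ} {z : I → L × L} {K : Set I}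
  {S : Set L}

theorem mk_eq_zero_of_rel {m : L →₀ Env L} (hm : DRel h z K S m) :
    (Submodule.Quotient.mk m : DiffModule h z K S) = 0 :=
  (Submodule.Quotient.mk_eq_zero _).2 (Submodule.subset_span hm)

local notation "d" => dK h z K S

theorem dK_linear (r s : ℂ) (a b : L) : d (r • a + s • b) = r • d a + s • d b := by
  have := mk_eq_zero_of_rel (DRel.linear (h := h) (z := z) (K := K) (S := S) r s a b)
  rw [sub_sub] at this
  exact sub_eq_zero.1 this

theorem dK_add (a b : L) : d (a + b) = d a + d b := by
  simpa using dK_linear (h := h) (z := z) (K := K) (S := S) 1 1 a b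

theorem dK_smul (r : ℂ) (a : L) : d (r • a) = r • d a := by
  simpa using dK_linear (h := h) (z := z) (K := K) (S := S) r 0 a 0

theorem dK_neg (a : L) : d (-a) = -d a := by
  simpa using dK_smul (h := h) (z := z) (K := K) (S := S) (-1) a

theorem dK_zero : d 0 = 0 := by
  simpa using dK_smul (h := h) (z := z) (K := K) (S := S) 0 0

theorem dK_sub (a b : L) : d (a - b) = d a - d b := by
  rw [sub_eq_add_neg, dK_add, dK_neg, sub_eq_add_neg]

theorem dK_mul (a b : L) : d (a * b) = ract (d a) b + lact a (d b) := by
  have := mk_eq_zero_of_rel (DRel.leibniz (h := h) (z := z) (K := K) (S := S) a b)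
  rw [sub_sub] at this
  exact sub_eq_zero.1 this

theorem dK_one : d 1 = 0 := mk_eq_zero_of_rel DRel.one

theorem dK_algebraMap (r : ℂ) : d (algebraMap ℂ L r) = 0 := by
  rw [Algebra.algebraMap_eq_smul_one, dK_smul, dK_one, smul_zero]

theorem dK_inv {a : L} (ha : a ≠ 0) : d a⁻¹ = -lact a⁻¹ (ract (d a) a⁻¹) := by
  have h1 := dK_mul (h := h) (z := z) (K := K) (S := S) a a⁻¹
  rw [mul_inv_cancel₀ ha, dK_one] at h1
  have h2 := congrArg (lact a⁻¹) h1
  rw [lact_zero, lact_add, lact_lact, inv_mul_cancel₀ ha, lact_one] at h2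
  exact (neg_eq_of_add_eq_zero_right h2.symm).symm

theorem dK_inv_eq_zero {a : L} (ha : d a = 0) : d a⁻¹ = 0 := by
  rcases eq_or_ne a 0 with rfl | h0
  · rw [inv_zero, dK_zero]
  · rw [dK_inv h0, ha, ract_zero, lact_zero, neg_zero]

variable {j : I}

theorem dy_y (hj : j ∈ K) (i : I) : ract (d (z j).2) (z i).2 = lact (z i).2 (d (z j).2) := by
  have := mk_eq_zero_of_rel (DRel.dy_y (h := h) (z := z) (K := K) (S := S) i j hj)
  exact sub_eq_zero.1 this

theorem dx_y (hj : j ∈ K) (i : I) : ract (d (z j).1) (z i).2 =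
    lact (z i).2 (d (z j).1) + h • lact (z i).2 (d (z j).2) := by
  have := mk_eq_zero_of_rel (DRel.dx_y (h := h) (z := z) (K := K) (S := S) i j hj)
  rw [sub_sub] at this
  exact sub_eq_zero.1 this

theorem dy_x (hj : j ∈ K) (i : I) : ract (d (z j).2) (z i).1 =
    lact ((z i).1 - h • (z i).2) (d (z j).2) := by
  have := mk_eq_zero_of_rel (DRel.dy_x (h := h) (z := z) (K := K) (S := S) i j hj)
  rw [sub_add] at this
  rw [lact_sub_left, lact_smul_left]
  exact sub_eq_zero.1 this

theorem dx_x (hj : j ∈ K) (i : I) : ract (d (z j).1) (z i).1 =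
    lact ((z i).1 + h • (z i).2) (d (z j).1)
      + lact (h ^ 2 • (z i).2 - h • (z i).1) (d (z j).2) := by
  have := mk_eq_zero_of_rel (DRel.dx_x (h := h) (z := z) (K := K) (S := S) i j hj)
  have h2 : ract (d (z j).1) (z i).1 - lact (z i).1 (d (z j).1)
        + h • lact (z i).1 (d (z j).2) - h • lact (z i).2 (d (z j).1)
        - h ^ 2 • lact (z i).2 (d (z j).2) = 0 := this
  rw [lact_sub_left, lact_add_left, lact_smul_left, lact_smul_left, lact_smul_left,
    ← sub_eq_zero, ← h2]
  abel

variable (hp : ∀ i k, HPair h (z i) (z k)) {b : I} (hb : b ∉ K) (h0 : (z b).2 ≠ 0)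

include hb

theorem dK_base : d (z b).1 = 0 ∧ d (z b).2 = 0 :=
  ⟨mk_eq_zero_of_rel (DRel.const_x b hb), mk_eq_zero_of_rel (DRel.const_y b hb)⟩

include hp h0

/-- As $b$ is constant, the differential is $dy_k\cdot y_b^{-1}$; the corrections from moving $x_i$
past $dy_k$ and past $y_b^{-1}$ cancel. -/
theorem commute_dK_beta (i k : I) :
    lact (z i).1 (d ((z k).2 * (z b).2⁻¹)) = ract (d ((z k).2 * (z b).2⁻¹)) (z i).1 ∧
      lact (z i).2 (d ((z k).2 * (z b).2⁻¹)) = ract (d ((z k).2 * (z b).2⁻¹)) (z i).2 := by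
  have hη := dK_inv_eq_zero (dK_base (h := h) (z := z) (S := S) hb).2
  rw [dK_mul, hη, lact_zero, add_zero]
  by_cases hk : k ∈ K
  · have e1 : (z i).2 * (z b).2⁻¹ = (z b).2⁻¹ * (z i).2 := by
      rw [mul_inv_eq_iff_eq_mul₀ h0, mul_assoc, (hp b i).yy, inv_mul_cancel_left₀ h0]
    have e2 : (z b).2⁻¹ * (z i).1 = (z i).1 * (z b).2⁻¹ + h • ((z i).2 * (z b).2⁻¹) := by
      rw [inv_mul_eq_iff_eq_mul₀ h0, mul_add, ← mul_assoc, mul_smul_comm, ← mul_assoc,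
        ← (hp b i).yy, mul_inv_cancel_right₀ h0, (hp b i).symm.yx, sub_mul,
        mul_inv_cancel_right₀ h0, smul_mul_assoc, mul_inv_cancel_right₀ h0, sub_add_cancel]
    constructor
    · rw [lact_ract, ract_ract, e2, ract_add_right, ract_smul_right, ← ract_ract, ← ract_ract,
        dy_x hk, dy_y hk, ← ract_smul, ← ract_add, ← lact_smul_left, ← lact_add_left,
        sub_add_cancel]
    · rw [lact_ract, ract_ract, ← e1, ← ract_ract, dy_y hk]
  · rw [(dK_base hk).2]
    simp only [ract_zero, lact_zero, and_self]

omit h0 in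
-- As $b$ is constant, the differential is $dx_k\cdot y_b-x_b\,dy_k$, and the bimodule relations
-- imitate those of the coordinates, so the cancellation behind the centrality of brackets recurs.
theorem commute_dK_alpha (i k : I) :
    lact (z i).1 (d (br h (z k) (z b))) = ract (d (br h (z k) (z b))) (z i).1 ∧
      lact (z i).2 (d (br h (z k) (z b))) = ract (d (br h (z k) (z b))) (z i).2 := by
  rw [(hp k b).br_eq, dK_sub, dK_mul, dK_mul, (dK_base hb).1, (dK_base hb).2, lact_zero,
    ract_zero, add_zero, zero_add]
  by_cases hk : k ∈ K
  · rw [dx_y hk]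
    constructor
    · simp only [ract_add, ract_sub, ← lact_ract, dx_x hk, dy_x hk, lact_add, lact_sub,
        lact_lact, ← lact_smul_left, mul_smul_comm, smul_mul_assoc]
      have e1 : (z i).1 * (z b).2 = (z b).2 * ((z i).1 + h • (z i).2) := by
        rw [(hp b i).xy, mul_add, mul_smul_comm]
      have e2 : h • ((z i).1 * (z b).2) - (z i).1 * (z b).1 =
          (z b).2 * (h ^ 2 • (z i).2 - h • (z i).1) + h • ((z b).2 * ((z i).1 - h • (z i).2))
            - (z b).1 * ((z i).1 - h • (z i).2) := by
        rw [(hp b i).xx, (hp b i).xy]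
        simp only [mul_sub, mul_smul_comm, smul_sub, smul_add, smul_smul, sq]
        abel
      rw [e1] at e2 ⊢
      rw [add_sub_assoc, ← lact_sub_left, e2, lact_sub_left, lact_add_left]
      abel
    · simp only [ract_add, ract_sub, ← lact_ract, dx_y hk, dy_y hk, lact_add, lact_sub,
        lact_lact, ← lact_smul_left, mul_smul_comm, smul_mul_assoc]
      have e2 : h • ((z i).2 * (z b).2) - (z i).2 * (z b).1 =
          h • ((z b).2 * (z i).2) + h • ((z b).2 * (z i).2) - (z b).1 * (z i).2 := by
        rw [(hp i b).xy, (hp i b).yy]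
        abel
      rw [add_sub_assoc, ← lact_sub_left, e2, lact_sub_left, lact_add_left, (hp b i).yy]
      abel
  · rw [(dK_base hk).2, (dK_base hk).1]
    simp only [ract_zero, lact_zero, sub_zero, and_self]

end diff

/-! ### Functionals over the center -/

section functional

variable {L M : Type*} [DivisionRing L] [Algebra ℂ L] [AddCommGroup M] [Module (Env L) M]

/-- The center of `L` in the enveloping algebra, acting from the left. -/
def envCenter (L : Type*) [DivisionRing L] [Algebra ℂ L] : Subring.center L →+* Env L where
  toFun c := envMk (c : L) 1
  map_one' := envMk_one
  map_mul' a b := by rw [envMk_mul, one_mul, Subring.coe_mul]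
  map_zero' := TensorProduct.zero_tmul _ _
  map_add' a b := by rw [Subring.coe_add, envMk_add_left]

/-- An element of a bimodule vanishes if all functionals that are linear over the center (acting
from the left) vanish on it. -/
theorem eq_zero_of_forall_functional {m : M}
    (hm : ∀ f : M →+ Subring.center L, (∀ (c : Subring.center L) n, f (lact (c : L) n) = c * f n) →
      f m = 0) : m = 0 := by
  -- The center is a field, so the bimodule is a vector space over it and its dual separates points.
  let : Module (Subring.center L) M := Module.compHom M (envCenter L)
  exact (Module.forall_dual_apply_eq_zero_iff (Subring.center L) m).1 fun f =>
    hm f.toAddMonoidHom fun c n => f.map_smul c n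

end functional

theorem brProd_pt {I L : Type*} [DivisionRing L] [Algebra ℂ L] {h : ℂ} {z : I → L × L} {b : I}
    (hb : HPair h (z b) (z b)) (h0 : (z b).2 ≠ 0) {A B : I → Subring.center L}
    (hz : ∀ i, z i = pt (z b) (A i, B i)) (p : Subring.center L × Subring.center L) (l : List I) :
    brProd h z (pt (z b) p) l =
      (((l.map fun i => det₂ p (A i, B i)).prod : Subring.center L) : L) := by
  rw [brProd]
  induction l with
  | nil => rfl
  | cons i l ih =>
    rw [List.map_cons, List.prod_cons, List.map_cons, List.prod_cons, ih, Subring.coe_mul,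
      ← br_pt hb h0, ← hz]

/-! ### Reduction of differentials to derivations of the center -/

section leibniz

variable {I L : Type*} [DivisionRing L] [Algebra ℂ L] (h : ℂ) (z : I → L × L) (K : Set I)
  (S : Set L)

local notation "d" => dK h z K S

/-- The elements whose differential commutes with a given central element. -/
def leibnizSubfield (c : Subring.center L) :
    Subfield L where
  carrier := {a | lact (c : L) (dK h z K S a) = ract (dK h z K S a) (c : L)}
  mul_mem' {a b} ha hb := by
    change lact _ _ = ract _ _
    rw [dK_mul, lact_add, ract_add, lact_ract, show lact (c : L) (d a) = ract (d a) (c : L) from ha,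
      ract_ract, ract_ract, center_comm, ← lact_ract,
      ← show lact (c : L) (d b) = ract (d b) (c : L) from hb,
      lact_lact, lact_lact, center_comm]
  one_mem' := by change lact _ _ = ract _ _; rw [dK_one, lact_zero, ract_zero]
  add_mem' {a b} ha hb := by
    change lact _ _ = ract _ _
    rw [dK_add, lact_add, ract_add, show lact (c : L) (d a) = ract (d a) (c : L) from ha,
      show lact (c : L) (d b) = ract (d b) (c : L) from hb]
  zero_mem' := by change lact _ _ = ract _ _; rw [dK_zero, lact_zero, ract_zero]
  neg_mem' {a} ha := by
    change lact _ _ = ract _ _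
    rw [dK_neg, lact_neg, ract_neg, show lact (c : L) (d a) = ract (d a) (c : L) from ha]
  inv_mem' a ha := by
    change lact _ _ = ract _ _
    rcases eq_or_ne a 0 with rfl | h0
    · rw [inv_zero, dK_zero, lact_zero, ract_zero]
    · rw [dK_inv h0, lact_neg, ract_neg, lact_lact, ← center_comm, ← lact_lact, lact_ract,
        show lact (c : L) (d a) = ract (d a) (c : L) from ha, ract_ract, ← lact_ract, ract_ract,
        center_comm]

end leibniz

section diff

variable {h : ℂ} {I : Type*} [LinearOrder I] {Q : Type*} [DivisionRing Q] [Algebra ℂ Q]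
  {j : HAlg h I →ₐ[ℂ] Q} {L : Type*} [DivisionRing L] [Algebra ℂ L] (e : Q →ₐ[ℂ] L)
  {z : I → L × L} (hz : ∀ i, z i = (e (j (coordX h i)), e (j (coordY h i))))
  (hQ : IsRightQuotientDivisionRing j) {S : Set L}
  (hL : Algebra.adjoin ℂ (Set.range e ∪ S) = ⊤) {K : Set I}

local notation "d" => dK h z K S

include hz hQ hL

theorem lact_dK_of_commute {a : L}
    (hx : ∀ i, lact (z i).1 (d a) = ract (d a) (z i).1)
    (hy : ∀ i, lact (z i).2 (d a) = ract (d a) (z i).2) (c : L) :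
    lact c (d a) = ract (d a) c :=
  mem_subfield_of_generators e hz hQ hL (commutant (d a))
    (fun r => mem_commutant.2 (by rw [← smul_eq_lact, ← smul_eq_ract]))
    (fun i => mem_commutant.2 (hx i)) (fun i => mem_commutant.2 (hy i))
    (fun σ hσ => mem_commutant.2 (sub_eq_zero.1 (mk_eq_zero_of_rel (DRel.central_left σ hσ a)))) c

variable {b : I} {A B : I → Subring.center L} (hA : ∀ i, (A i : L) = br h (z i) (z b))
  (hB : ∀ i, (B i : L) = (z i).2 * ((z b).2)⁻¹) (hb : b ∉ K)

include hA hB hb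

/-- The elements whose differential commutes with $c$ form a skew subfield. It contains the
$A_i,B_i$, whose differentials commute with all of $L$, the base pair, whose differentials vanish,
and the adjoined elements, by the relation $a\,d\sigma=d\sigma\,a$. These generate $L$. -/
theorem lact_center_dK (c : Subring.center L) (a : L) :
    lact (c : L) (d a) = ract (d a) (c : L) := by
  have hp := hPair_coords e hz
  have h0 := coords_snd_ne_zero e hz hQ b
  have hAc : ∀ i, (A i : L) ∈ leibnizSubfield h z K S c := fun i =>
    lact_dK_of_commute e hz hQ hL (by rw [hA]; exact fun k => (commute_dK_alpha hp hb k i).1)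
      (by rw [hA]; exact fun k => (commute_dK_alpha hp hb k i).2) c
  have hBc : ∀ i, (B i : L) ∈ leibnizSubfield h z K S c := fun i =>
    lact_dK_of_commute e hz hQ hL (by rw [hB]; exact fun k => (commute_dK_beta hp hb h0 k i).1)
      (by rw [hB]; exact fun k => (commute_dK_beta hp hb h0 k i).2) c
  have hzero : ∀ {a : L}, d a = 0 → a ∈ leibnizSubfield h z K S c := fun {a} ha => by
    change lact _ _ = ract _ _
    rw [ha, lact_zero, ract_zero]
  have hxb := hzero (dK_base hb).1
  have hyb := hzero (dK_base hb).2
  have hzi := fun i => (hp b i).pt_eq h0 (hA i) (hB i)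
  refine mem_subfield_of_generators e hz hQ hL (leibnizSubfield h z K S c)
    (fun r => hzero (dK_algebraMap r)) (fun i => ?_) (fun i => ?_) (fun σ hσ => ?_) a
  · rw [hzi i]
    exact add_mem (mul_mem (hAc i) (inv_mem hyb))
      (mul_mem (hBc i) (mul_mem (mul_mem hxb (inv_mem hyb)) hyb))
  · rw [hzi i]
    exact mul_mem (hBc i) hyb
  · exact sub_eq_zero.1 (mk_eq_zero_of_rel (DRel.central_right σ hσ c))

/-- Differentiate $ac=ca$ and cancel $c\,da=da\,c$. -/
theorem lact_dK_center (c : Subring.center L) (a : L) : lact a (d c) = ract (d c) a := by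
  have h1 := congrArg (dK h z K S) (center_comm c a)
  rw [dK_mul, dK_mul, lact_center_dK e hz hQ hL hA hB hb, add_comm] at h1
  exact add_right_cancel h1

variable {f : DiffModule h z K S →+ Subring.center L}
  (hf : ∀ (c : Subring.center L) n, f (lact (c : L) n) = c * f n)

include hf

/-- Left and right multiplication by the center agree on differentials, so $f\circ d$ restricts to
an ordinary derivation of the center. -/
theorem functional_dK_mul (x y : Subring.center L) :
    f (d (x * y : Subring.center L)) = x * f (d y) + y * f (d x) := by
  rw [Subring.coe_mul, dK_mul, ← lact_center_dK e hz hQ hL hA hB hb, map_add, hf, hf, add_comm]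

/-- In $(du,u)$ the base pair drops out: its commutation correction cancels $-h\,dY\cdot Y$, which
leaves the Wronskian $p_2\,dp_1-p_1\,dp_2$ of the central coordinates. -/
theorem functional_dh (js : List I) (w : Subring.center L)
    (p : Subring.center L × Subring.center L) :
    f (dh h z K S js (w : L) (pt (z b) p)) = w⁻¹ * (js.map fun i => det₂ p (A i, B i)).prod *
      (p.2 * f (d p.1) - p.1 * f (d p.2)) := by
  have hp := hPair_coords e hz
  have h0 := coords_snd_ne_zero e hz hQ b
  have hzi := fun i => (hp b i).pt_eq h0 (hA i) (hB i)
  have hη := dK_inv_eq_zero (dK_base (h := h) (z := z) (S := S) hb).2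
  have hbr : dbr h z K S (pt (z b) p) = lact (p.2 : L) (d p.1) - lact (p.1 : L) (d p.2) := by
    simp only [dbr, pt, center_smul_eq, inv_mul_cancel_right₀ h0]
    rw [dK_add, dK_mul, dK_mul, dK_mul, (dK_base hb).1, (dK_base hb).2, hη]
    simp only [lact_zero, add_zero, ract_add, ract_ract]
    have e1 : (z b).2⁻¹ * (p.2 * (z b).2) = p.2 := by
      rw [← mul_assoc, center_comm, mul_assoc, inv_mul_cancel₀ h0, mul_one]
    have e2 : (z b).1 * (p.2 * (z b).2) = (z b).2 * (p.1 * (z b).2⁻¹ + p.2 * (z b).1)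
        + h • ((z b).2 * (p.2 * (z b).2)) - p.1 := by
      rw [mul_add, ← mul_assoc, ← mul_assoc, ← mul_assoc, ← mul_assoc, center_comm, center_comm,
        center_comm, mul_assoc, mul_assoc (p.1 : L), mul_inv_cancel₀ h0, (hp b b).xy, mul_add,
        mul_one, mul_assoc, mul_assoc, mul_smul_comm]
      abel
    have e3 (m : DiffModule h z K S) (x y : L) : ract m (x - y) = ract m x - ract m y := by
      rw [sub_eq_add_neg, ract_add_right, ract_neg_right, sub_eq_add_neg]
    rw [e1, e2, e3, ract_add_right, ract_smul_right, lact_dK_center e hz hQ hL hA hB hb,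
      lact_dK_center e hz hQ hL hA hB hb]
    abel
  rw [dh, hbr, brProd_pt (hp b b) h0 hzi]
  have : (w : L)⁻¹ * (((js.map fun i => det₂ p (A i, B i)).prod : Subring.center L) : L) =
      ((w⁻¹ * (js.map fun i => det₂ p (A i, B i)).prod : Subring.center L) : L) := rfl
  rw [this, hf, map_sub, hf, hf]

end diff

/-! ### Binary forms -/

section forms

variable {K : Type*} [Field K]

theorem det₂_eq_zero_of_eq_zero {u v w : K × K} (hu : u ≠ 0) (hv : det₂ u v = 0)
    (hw : det₂ u w = 0) : det₂ v w = 0 := by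
  have h1 : u.1 * det₂ v w = 0 := by
    simp only [det₂] at *; linear_combination v.1 * hw - w.1 * hv
  have h2 : u.2 * det₂ v w = 0 := by
    simp only [det₂] at *; linear_combination v.2 * hw - w.2 * hv
  by_contra h
  exact hu (Prod.ext ((mul_eq_zero.1 h1).resolve_right h) ((mul_eq_zero.1 h2).resolve_right h))

/-- The product of the linear forms `det (·, v)`, `v ∈ vs`. -/
def linProd (vs : List (K × K)) (w : K × K) : K := (vs.map (det₂ w)).prod

/-- The Euler–Jacobi relation for binary forms: the residues of a product of `n` linear forms
at `n + 2` distinct points of the projective line sum to zero. -/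
theorem sum_residue {ι : Type*} [DecidableEq ι] (π : ι → K × K) (n : ℕ) (s : Finset ι)
    (hs : s.card = n + 2) (hπ : ∀ l ∈ s, ∀ m ∈ s, l ≠ m → det₂ (π l) (π m) ≠ 0)
    (vs : List (K × K)) (hvs : vs.length = n) :
    ∑ l ∈ s, linProd vs (π l) / ∏ m ∈ s.erase l, det₂ (π l) (π m) = 0 := by
  induction n generalizing s vs with
  | zero =>
    obtain ⟨a, b, hab, rfl⟩ := Finset.card_eq_two.1 hs
    rw [List.length_eq_zero_iff] at hvs
    subst hvs
    rw [Finset.sum_pair hab]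
    have e1 : ({a, b} : Finset ι).erase a = {b} := by ext; simp; grind
    have e2 : ({a, b} : Finset ι).erase b = {a} := by ext; simp; grind
    have h1 := hπ a (by simp) b (by simp) hab
    have h2 := hπ b (by simp) a (by simp) hab.symm
    rw [e1, e2]
    simp only [linProd, List.map_nil, List.prod_nil, Finset.prod_singleton]
    field_simp
    simp only [det₂]
    ring
  | succ n ih =>
    obtain ⟨v, vs, rfl⟩ : ∃ v vs', vs = v :: vs' := by
      cases vs with
      | nil => simp at hvs
      | cons v vs => exact ⟨v, vs, rfl⟩
    have hvs' : vs.length = n := by simpa using hvs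
    obtain ⟨a, ha, b, hb, hab⟩ := Finset.one_lt_card.1 (show 1 < s.card by omega)
    -- If the form contains the factor $\det(\cdot,\pi_a)$, the term at $a$ vanishes and the factor
    -- cancels in all others, leaving the case of one point and one factor fewer.
    have key : ∀ a ∈ s, ∑ l ∈ s, det₂ (π l) (π a) * linProd vs (π l) /
        ∏ m ∈ s.erase l, det₂ (π l) (π m) = 0 := by
      intro a ha
      have h0 := ih (s.erase a) (by rw [Finset.card_erase_of_mem ha]; omega)
        (fun l hl m hm => hπ l (Finset.mem_of_mem_erase hl) m (Finset.mem_of_mem_erase hm)) vs hvs'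
      rw [← Finset.add_sum_erase s _ ha, ← h0]
      have : det₂ (π a) (π a) = 0 := by simp only [det₂]; ring
      rw [this, zero_mul, zero_div, zero_add]
      refine Finset.sum_congr rfl fun l hl => ?_
      have hla := (Finset.mem_erase.1 hl).1
      have hls := (Finset.mem_erase.1 hl).2
      rw [← Finset.mul_prod_erase (s.erase l) _ (Finset.mem_erase.2 ⟨hla.symm, ha⟩),
        Finset.erase_right_comm, mul_div_mul_left _ _ (hπ l hls a ha hla)]
    have hd := hπ a ha b hb hab
    -- Cramer's rule writes `v` in terms of $\pi_a,\pi_b$, so an arbitrary form is a combination of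
    -- two forms covered by `key`.
    have hlin : ∀ w, linProd (v :: vs) w = det₂ v (π b) / det₂ (π a) (π b) *
        (det₂ w (π a) * linProd vs w) + det₂ (π a) v / det₂ (π a) (π b) *
        (det₂ w (π b) * linProd vs w) := by
      intro w
      simp only [linProd, List.map_cons, List.prod_cons]
      field_simp
      simp only [det₂]
      ring
    simp only [hlin, add_div, mul_div_assoc, Finset.sum_add_distrib, ← Finset.mul_sum]
    have k1 := key a ha
    have k2 := key b hb
    simp only [mul_div_assoc] at k1 k2
    rw [k1, k2, mul_zero, mul_zero, add_zero]

/-- Binary forms of degree `n` that are sums of products of linear forms, as functions. -/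
def formSpan (K : Type*) [Field K] (n : ℕ) : Submodule K (K × K → K) :=
  Submodule.span K {f | ∃ vs : List (K × K), vs.length = n ∧ linProd vs = f}

theorem formSpan_mul {m n : ℕ} {f g : K × K → K} (hf : f ∈ formSpan K m) (hg : g ∈ formSpan K n) :
    f * g ∈ formSpan K (m + n) := by
  induction hf using Submodule.span_induction with
  | mem f hf =>
    obtain ⟨vs, hvs, rfl⟩ := hf
    induction hg using Submodule.span_induction with
    | mem g hg =>
      obtain ⟨vs', hvs', rfl⟩ := hg
      refine Submodule.subset_span ⟨vs ++ vs', by simp [hvs, hvs'], ?_⟩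
      ext w
      simp [linProd]
    | zero => simp
    | add g g' _ _ hg hg' => rw [mul_add]; exact add_mem hg hg'
    | smul c g _ hg => rw [mul_smul_comm]; exact Submodule.smul_mem _ _ hg
  | zero => simp
  | add f f' _ _ hf hf' => rw [add_mul]; exact add_mem hf hf'
  | smul c f _ hf => rw [smul_mul_assoc]; exact Submodule.smul_mem _ _ hf

theorem sum_residue_form {ι : Type*} [DecidableEq ι] (π : ι → K × K) {n : ℕ} {s : Finset ι}
    (hs : s.card = n + 2) (hπ : ∀ l ∈ s, ∀ m ∈ s, l ≠ m → det₂ (π l) (π m) ≠ 0)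
    {f : K × K → K} (hf : f ∈ formSpan K n) :
    ∑ l ∈ s, f (π l) / ∏ m ∈ s.erase l, det₂ (π l) (π m) = 0 := by
  induction hf using Submodule.span_induction with
  | mem f hf =>
    obtain ⟨vs, hvs, rfl⟩ := hf
    exact sum_residue π n s hs hπ vs hvs
  | zero => simp
  | add f g _ _ hf hg => simp only [Pi.add_apply, add_div, Finset.sum_add_distrib, hf, hg, add_zero]
  | smul c f _ hf =>
    simp only [Pi.smul_apply, smul_eq_mul, mul_div_assoc, ← Finset.mul_sum, hf, mul_zero]

end forms

/-! ### Deformations over the dual numbers -/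

section dual

open TrivSqZeroExt

variable {K : Type*} [Field K]

/-- The image of a vector under a ring homomorphism. -/
def mapVec {R S : Type*} [CommRing R] [CommRing S] (φ : R →+* S) (v : R × R) : S × S :=
  (φ v.1, φ v.2)

theorem det₂_mapVec {R S : Type*} [CommRing R] [CommRing S] (φ : R →+* S) (u v : R × R) :
    det₂ (mapVec φ u) (mapVec φ v) = φ (det₂ u v) := by
  simp [det₂, mapVec]

/-- The homomorphism to the dual numbers given by a derivation. -/
def dualHom (D : K → K) (hadd : ∀ a b, D (a + b) = D a + D b)
    (hmul : ∀ a b, D (a * b) = a * D b + b * D a) : K →+* DualNumber K where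
  toFun a := inl a + inr (D a)
  map_one' := by
    have := hmul 1 1
    simp only [mul_one, one_mul, left_eq_add] at this
    rw [this]; simp
  map_mul' a b := by
    ext <;> simp [hmul]
    ring
  map_zero' := by
    have := hadd 0 0
    simp only [add_zero, left_eq_add] at this
    rw [this]; simp
  map_add' a b := by ext <;> simp [hadd]

variable {D : K → K} {hadd : ∀ a b, D (a + b) = D a + D b}
    {hmul : ∀ a b, D (a * b) = a * D b + b * D a}

@[simp] theorem fst_dualHom (a : K) : fst (dualHom D hadd hmul a) = a := by
  simp [dualHom]

@[simp] theorem snd_dualHom (a : K) : snd (dualHom D hadd hmul a) = D a := by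
  simp [dualHom]

theorem fst_det₂ (u v : DualNumber K × DualNumber K) :
    fst (det₂ u v) = det₂ (fst u.1, fst u.2) (fst v.1, fst v.2) := by
  simp [det₂]

theorem snd_det₂ (u v : DualNumber K × DualNumber K) :
    snd (det₂ u v) = det₂ (fst u.1, fst u.2) (snd v.1, snd v.2)
      + det₂ (snd u.1, snd u.2) (fst v.1, fst v.2) := by
  simp [det₂]
  ring

theorem fst_prod_det₂ {I : Type*} (u : DualNumber K × DualNumber K)
    (v : I → DualNumber K × DualNumber K) (l : List I) :
    fst ((l.map fun i => det₂ u (v i)).prod) =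
      (l.map fun i => det₂ (fst u.1, fst u.2) (fst (v i).1, fst (v i).2)).prod := by
  induction l with
  | nil => simp
  | cons i l ih => simp [ih, fst_det₂]

/-- The derivative of a product of linear forms with respect to its coefficients is a form. -/
theorem snd_prod_mem_formSpan {I : Type*} (v : I → DualNumber K × DualNumber K) (l : List I) :
    (fun w : K × K => snd ((l.map fun i => det₂ (mapVec (inlHom K K) w) (v i)).prod)) ∈
      formSpan K l.length := by
  induction l with
  | nil =>
    simp only [List.map_nil, List.prod_nil, snd_one]
    exact zero_mem (formSpan K 0)
  | cons i l ih =>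
    have h1 : ∀ u : K × K, (fun w => det₂ w u) ∈ formSpan K 1 := fun u =>
      Submodule.subset_span ⟨[u], rfl, by ext; simp [linProd]⟩
    have h2 : (fun w : K × K => fst ((l.map fun i => det₂ (mapVec (inlHom K K) w) (v i)).prod)) ∈
        formSpan K l.length := by
      refine Submodule.subset_span ⟨l.map fun i => (fst (v i).1, fst (v i).2), by simp, ?_⟩
      ext w
      rw [fst_prod_det₂]
      simp [linProd, mapVec, Function.comp_def]
    have h3 := formSpan_mul (h1 (fst (v i).1, fst (v i).2)) ih
    rw [add_comm] at h3
    have h3 := add_mem h3 (formSpan_mul h2 (h1 (snd (v i).1, snd (v i).2)))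
    refine (congrArg (· ∈ formSpan K (l.length + 1)) (funext fun w => ?_)).mpr h3
    have h0 (u : K × K) : det₂ ((0 : K), (0 : K)) u = 0 := by simp [det₂]
    simp only [List.map_cons, List.prod_cons, DualNumber.snd_mul, snd_det₂, fst_det₂, Pi.add_apply,
      Pi.mul_apply, mapVec, inlHom_apply, fst_inl, snd_inl, h0, add_zero]
    ring

end dual

/-! ### Abel's theorem over a field with a derivation -/

section

open TrivSqZeroExt

/-- The product of the linear forms vanishing at the points with the given indices. -/
def pointProd {I R : Type*} [CommRing R] (p : I → R × R) (l : List I) (w : R × R) : R :=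
  (l.map fun i => det₂ w (p i)).prod

theorem pointProd_map {I R S : Type*} [CommRing R] [CommRing S] (φ : R →+* S) (p : I → R × R)
    (l : List I) (w : R × R) :
    pointProd (fun i => mapVec φ (p i)) l (mapVec φ w) = φ (pointProd p l w) := by
  rw [pointProd, pointProd, map_list_prod, List.map_map]
  congr 1
  exact List.map_congr_left fun i _ => det₂_mapVec φ w (p i)

theorem pointProd_append {I R : Type*} [CommRing R] (p : I → R × R) (l l' : List I) (w : R × R) :
    pointProd p (l ++ l') w = pointProd p l w * pointProd p l' w := by
  simp [pointProd]

theorem exists_of_pointProd_eq_zero {I K : Type*} [Field K] {p : I → K × K} {l : List I}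
    {w : K × K} (h : pointProd p l w = 0) : ∃ i ∈ l, det₂ w (p i) = 0 := by
  rw [pointProd, List.prod_eq_zero_iff, List.mem_map] at h
  exact h

variable {I K : Type*} [Field K]

/-- Two products of linear forms without a common zero. -/
theorem pointProd_ne_zero {p : I → K × K} (hdet : ∀ i k, i ≠ k → det₂ (p i) (p k) ≠ 0)
    {l l' : List I} (hl : ∀ i ∈ l, i ∉ l') {w : K × K} (hw : w ≠ 0) (h : pointProd p l w = 0) :
    pointProd p l' w ≠ 0 := by
  intro h'
  obtain ⟨i, hi, hi0⟩ := exists_of_pointProd_eq_zero h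
  obtain ⟨k, hk, hk0⟩ := exists_of_pointProd_eq_zero h'
  exact hdet i k (fun hik => hl i hi (hik ▸ hk)) (det₂_eq_zero_of_eq_zero hw hi0 hk0)

variable {p : I → K × K} {is ks ls js : List I} {s k : ℕ} {π : Fin k → K × K} {C : K}
  {W : Fin k → K}

/-- The relation between the two products of a double cover at a branch of the intersection. -/
theorem exists_sign {a b P Q w : K} (ha : a ≠ 0) (hP : P ≠ 0) (hQ : Q ≠ 0) (hw : w ^ 2 = a * b)
    (h : a * P ^ 2 = b * Q ^ 2) :
    ∃ ε : ℤ, (ε = 1 ∨ ε = -1) ∧ a * P = ε * (w * Q) ∧ b * Q = ε * (w * P) ∧ w ≠ 0 := by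
  have h1 : (a * P) ^ 2 = (w * Q) ^ 2 := by
    rw [mul_pow w, hw]; linear_combination a * h
  have h2 : ∀ ε : K, a * P = ε * (w * Q) → b * Q = ε * (w * P) := fun ε hε => by
    apply mul_left_cancel₀ hQ
    linear_combination P * hε - h
  have hw0 : w ≠ 0 := by
    rintro rfl
    have : (a * P) ^ 2 ≠ 0 := pow_ne_zero 2 (mul_ne_zero ha hP)
    exact this (by rw [h1]; ring)
  rcases sq_eq_sq_iff_eq_or_eq_neg.1 h1 with h1 | h1
  · exact ⟨1, Or.inl rfl, by simpa using h1, by simpa using h2 1 (by simpa using h1), hw0⟩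
  · exact ⟨-1, Or.inr rfl, by simpa using h1, by simpa using h2 (-1) (by simpa using h1), hw0⟩

variable (hdet : ∀ i k, i ≠ k → det₂ (p i) (p k) ≠ 0) (hnd : (is ++ ks ++ ls).Nodup)
  (hpoly : ∀ (φ : K →+* DualNumber K) (w : DualNumber K × DualNumber K),
    pointProd (fun i => mapVec φ (p i)) (is.take s) w *
        pointProd (fun i => mapVec φ (p i)) ks w ^ 2 -
      pointProd (fun i => mapVec φ (p i)) (is.drop s) w *
        pointProd (fun i => mapVec φ (p i)) ls w ^ 2
      = φ C * ∏ l, det₂ w (mapVec φ (π l)))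

include hpoly in
-- At $\pi_l$ one factor on the right is zero. The hypothesis `hpoly` ranges over homomorphisms to
-- the dual numbers so that it can also be differentiated; here only the constant embedding `inlHom`
-- is needed.
theorem eval_root (l : Fin k) :
    pointProd p (is.take s) (π l) * pointProd p ks (π l) ^ 2 =
      pointProd p (is.drop s) (π l) * pointProd p ls (π l) ^ 2 := by
  have h1 := hpoly (inlHom K K) (mapVec (inlHom K K) (π l))
  rw [Finset.prod_eq_zero (Finset.mem_univ l)
    (by rw [det₂_mapVec]; simp [det₂, mul_comm]), mul_zero] at h1
  simp only [pointProd_map] at h1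
  have h2 := congrArg fst h1
  simp only [← map_pow, ← map_mul, ← map_sub] at h2
  exact sub_eq_zero.1 h2

theorem disjoint_of_nodup (hnd : (is ++ ks ++ ls).Nodup) (s : ℕ) :
    ∀ i ∈ is.take s ++ ks, i ∉ is.drop s ++ ls := by
  have h1 : (is.take s ++ is.drop s ++ ks ++ ls).Nodup := by rwa [List.take_append_drop]
  intro i hi hi'
  simp only [List.nodup_append, List.mem_append] at h1 hi hi'
  grind

include hdet hnd hpoly

/-- By `eval_root`, a zero factor on one side forces one on the other. Then $\pi_l$ would be
proportional to two points with different indices, whose determinant is nonzero. -/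
theorem factors_ne_zero (hπ0 : ∀ l, π l ≠ 0) (l : Fin k) :
    pointProd p (is.take s) (π l) ≠ 0 ∧ pointProd p ks (π l) ≠ 0 ∧
      pointProd p ls (π l) ≠ 0 := by
  have h1 := eval_root hpoly l
  have h2 := fun h => pointProd_ne_zero hdet (disjoint_of_nodup hnd s) (hπ0 l) h
  simp only [pointProd_append] at h2
  refine ⟨fun h0 => ?_, fun h0 => ?_, fun h0 => ?_⟩
  · rw [h0, zero_mul, eq_comm, mul_eq_zero, pow_eq_zero_iff two_ne_zero, ← mul_eq_zero] at h1
    exact h2 (by rw [h0, zero_mul]) h1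
  · rw [h0, zero_pow two_ne_zero, mul_zero, eq_comm, mul_eq_zero, pow_eq_zero_iff two_ne_zero,
      ← mul_eq_zero] at h1
    exact h2 (by rw [h0, mul_zero]) h1
  · rw [h0, zero_pow two_ne_zero, mul_zero, mul_eq_zero, pow_eq_zero_iff two_ne_zero,
      ← mul_eq_zero] at h1
    exact h2 h1 (by rw [h0, mul_zero])

/-- Abel's theorem over a field with a derivation. -/
theorem exists_signs_sum_eq_zero (hπ0 : ∀ l, π l ≠ 0) (hC : C ≠ 0)
    (hne : ∀ l m, l ≠ m → det₂ (π l) (π m) ≠ 0)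
    (hW : ∀ l, W l ^ 2 = pointProd p is (π l)) (hk : js.length + (ks.length + ls.length) + 2 = k) :
    ∃ ε : Fin k → ℤ, (∀ l, ε l = 1 ∨ ε l = -1) ∧ ∀ D : K → K,
      (∀ a b, D (a + b) = D a + D b) → (∀ a b, D (a * b) = a * D b + b * D a) →
      (∀ i ∈ is, D (p i).1 = 0 ∧ D (p i).2 = 0) →
      ∑ l, ε l • ((W l)⁻¹ * pointProd p js (π l) *
        ((π l).2 * D (π l).1 - (π l).1 * D (π l).2)) = 0 := by
  have hW' : ∀ l, W l ^ 2 = pointProd p (is.take s) (π l) * pointProd p (is.drop s) (π l) :=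
    fun l => by rw [hW, ← pointProd_append, List.take_append_drop]
  choose hA hP hQ using factors_ne_zero hdet hnd hpoly hπ0
  choose ε hε hεA hεB hW0 using fun l =>
    exists_sign (hA l) (hP l) (hQ l) (hW' l) (eval_root hpoly l)
  -- The signs are fixed before the derivation, since they must serve all functionals at once.
  refine ⟨ε, hε, fun D hadd hmul hD => ?_⟩
  have hε2 : ∀ l, (ε l : K) * ε l = 1 := fun l => by
    rcases hε l with h | h <;> simp [h]
  set φ := dualHom D hadd hmul with hφ
  set T : List I → K × K → DualNumber K := fun l w =>
    pointProd (fun i => mapVec φ (p i)) l (mapVec (inlHom K K) w) with hT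
  have hTfst : ∀ l w, fst (T l w) = pointProd p l w := fun l w => by
    rw [hT]
    simp only [pointProd, fst_prod_det₂, mapVec, hφ, fst_dualHom, inlHom_apply, fst_inl]
  have hTsnd : ∀ l, (∀ i ∈ l, i ∈ is) → ∀ w, snd (T l w) = 0 := by
    intro l hl w
    have : T l w = inl (pointProd p l w) := by
      change pointProd _ _ _ = inlHom K K _
      rw [← pointProd_map, pointProd, pointProd]
      congr 1
      refine List.map_congr_left fun i hi => ?_
      congr 1
      refine Prod.ext ?_ ?_ <;> ext <;> simp [mapVec, hφ, hD i (hl i hi)]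
    rw [this, snd_inl]
  -- Compare infinitesimal parts when $D$ deforms the coefficients and the argument stays fixed at
  -- $\pi_l$. On the left $a,b$ are constant, giving $2aPP'-2bQQ'=2\epsilon w(QP'-PQ')$; on the
  -- right only the derivative of the $l$-th factor survives.
  have key : ∀ l, 2 * (ε l : K) * W l * (pointProd p ls (π l) * snd (T ks (π l)) -
      pointProd p ks (π l) * snd (T ls (π l))) =
      C * ((π l).1 * D (π l).2 - (π l).2 * D (π l).1) *
        ∏ m ∈ Finset.univ.erase l, det₂ (π l) (π m) := by
    intro l
    have h1 := congrArg snd (hpoly φ (mapVec (inlHom K K) (π l)))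
    rw [← Finset.mul_prod_erase _ _ (Finset.mem_univ l)] at h1
    change snd (T _ _ * T _ _ ^ 2 - T _ _ * T _ _ ^ 2) = _ at h1
    have h2 : fst (∏ m ∈ Finset.univ.erase l, det₂ (mapVec (inlHom K K) (π l)) (mapVec φ (π m))) =
        ∏ m ∈ Finset.univ.erase l, det₂ (π l) (π m) := by
      rw [← fstHom_apply (R := K) (M := K) (S := K), map_prod]
      refine Finset.prod_congr rfl fun m _ => ?_
      rw [fstHom_apply, fst_det₂]
      simp [mapVec, hφ]
    have h3 : fst (det₂ (mapVec (inlHom K K) (π l)) (mapVec φ (π l))) = 0 := by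
      rw [fst_det₂]
      simp [mapVec, hφ, det₂, mul_comm]
    have h4 : snd (det₂ (mapVec (inlHom K K) (π l)) (mapVec φ (π l))) =
        (π l).1 * D (π l).2 - (π l).2 * D (π l).1 := by
      rw [snd_det₂]
      simp [mapVec, hφ, det₂]
    have hφC : fst (φ C) = C := by rw [hφ, fst_dualHom]
    simp only [snd_sub, sq, DualNumber.snd_mul, fst_mul, hTfst,
      hTsnd _ (fun i hi => List.mem_of_mem_take hi), hTsnd _ (fun i hi => List.mem_of_mem_drop hi),
      h2, h3, h4, hφC] at h1
    linear_combination h1 - 2 * snd (T ks (π l)) * hεA l + 2 * snd (T ls (π l)) * hεB l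
  -- By `hk` this degree is $k-2$, as the residue relation at $k$ points requires.
  have hform : (fun w => pointProd p js w * (pointProd p ls w * snd (T ks w) -
      pointProd p ks w * snd (T ls w))) ∈
      formSpan K (js.length + (ks.length + ls.length)) := by
    have hlin : ∀ l : List I, pointProd p l ∈ formSpan K l.length := fun l =>
      Submodule.subset_span ⟨l.map p, by simp, by
        ext w; simp [linProd, pointProd, Function.comp_def]⟩
    refine formSpan_mul (hlin js) (sub_mem ?_ ?_)
    · rw [add_comm]
      exact formSpan_mul (hlin ls) (snd_prod_mem_formSpan _ ks)
    · exact formSpan_mul (hlin ks) (snd_prod_mem_formSpan _ ls)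
  have hres := sum_residue_form π (s := Finset.univ) (by simp [hk])
    (fun l _ m _ hlm => hne l m hlm) hform
  have : ∀ l, ε l • ((W l)⁻¹ * pointProd p js (π l) *
      ((π l).2 * D (π l).1 - (π l).1 * D (π l).2)) = -(2 / C) *
      (pointProd p js (π l) * (pointProd p ls (π l) * snd (T ks (π l)) -
        pointProd p ks (π l) * snd (T ls (π l))) /
        ∏ m ∈ Finset.univ.erase l, det₂ (π l) (π m)) := by
    intro l
    have hprod : ∏ m ∈ Finset.univ.erase l, det₂ (π l) (π m) ≠ 0 :=
      Finset.prod_ne_zero_iff.2 fun m hm => hne l m (Finset.ne_of_mem_erase hm).symm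
    have hw := hW0 l
    have hk := key l
    rw [zsmul_eq_mul]
    generalize ∏ m ∈ Finset.univ.erase l, det₂ (π l) (π m) = R at *
    field_simp
    linear_combination ((ε l : K) * pointProd p js (π l)) * hk - 2 * W l *
      pointProd p js (π l) * (pointProd p ls (π l) * snd (T ks (π l)) -
        pointProd p ks (π l) * snd (T ls (π l))) * hε2 l
  rw [Finset.sum_congr rfl fun l _ => this l, ← Finset.mul_sum, hres, mul_zero]

end

/-! ### Transcendence degree of a simple extension -/

open scoped IntermediateField.algebraAdjoinAdjoin in
/-- A simple extension has transcendence degree at most one. -/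
theorem not_algebraicIndependent_pair {E K : Type*} [Field E] [Field K] [Algebra E K] {τ a b : K}
    (ha : a ∈ IntermediateField.adjoin E {τ}) (hb : b ∈ IntermediateField.adjoin E {τ}) :
    ¬ AlgebraicIndependent E ![a, b] := by
  intro h
  have h1 : AlgebraicIndependent E
      ![(⟨a, ha⟩ : IntermediateField.adjoin E {τ}), ⟨b, hb⟩] := by
    refine AlgebraicIndependent.of_comp (IntermediateField.adjoin E {τ}).val ?_
    convert h using 1
    ext i
    fin_cases i <;> rfl
  -- The chain is
  -- $2\le\operatorname{trdeg}E(\tau)=\operatorname{trdeg}E[\tau]\le\operatorname{trdeg}E[T]=1$.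
  have h2 := h1.lift_cardinalMk_le_trdeg
  have : Algebra.IsAlgebraic (Algebra.adjoin E {τ}) (IntermediateField.adjoin E {τ}) :=
    IsLocalization.isAlgebraic _ (nonZeroDivisors _)
  have h3 := trdeg_add_eq E (Algebra.adjoin E {τ}) (A := IntermediateField.adjoin E {τ})
  rw [trdeg_eq_zero (R := Algebra.adjoin E {τ}), add_zero] at h3
  have hsurj : Function.Surjective ((Polynomial.aeval τ : Polynomial E →ₐ[E] K).codRestrict
      (Algebra.adjoin E {τ}) fun p => Polynomial.aeval_mem_adjoin_singleton E τ) := by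
    rintro ⟨x, hx⟩
    obtain ⟨p, rfl⟩ := (Algebra.adjoin_singleton_eq_range_aeval E τ ▸ hx :
      x ∈ (Polynomial.aeval τ : Polynomial E →ₐ[E] K).range)
    exact ⟨p, rfl⟩
  have h4 := lift_trdeg_le_of_surjective _ hsurj
  rw [h3, Polynomial.trdeg_of_isDomain] at h4
  simp at h2 h4
  have := h2.trans h4
  norm_num at this

/-! ### From an identity at a generic point to a polynomial identity -/

section pencil

/-- The difference of the two sides of the equation that expresses a member of a pencil as a
product of linear forms. -/
def pencil {I R : Type*} [CommRing R] (p : I → R × R) (t t' ks ls : List I) {k : ℕ} (C : R)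
    (π : Fin k → R × R) (w : R × R) : R :=
  pointProd p t w * pointProd p ks w ^ 2 - pointProd p t' w * pointProd p ls w ^ 2 -
    C * ∏ l, det₂ w (π l)

theorem pencil_map {I R S : Type*} [CommRing R] [CommRing S] (φ : R →+* S) (p : I → R × R)
    (t t' ks ls : List I) {k : ℕ} (C : R) (π : Fin k → R × R) (w : R × R) :
    pencil (fun i => mapVec φ (p i)) t t' ks ls (φ C) (fun l => mapVec φ (π l)) (mapVec φ w) =
      φ (pencil p t t' ks ls C π w) := by
  simp only [pencil, pointProd_map, det₂_mapVec, map_sub, map_mul, map_pow, map_prod]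

/-- Every value is a specialization of one polynomial in two variables over the coefficient field,
so vanishing at an algebraically independent pair kills them all. -/
theorem pencil_eq_eval₂Hom {I F S : Type*} [CommRing F] [CommRing S] (ψ : F →+* S)
    (p : I → F × F) (t t' ks ls : List I) {k : ℕ} (C : F) (π : Fin k → F × F) (w : S × S) :
    pencil (fun i => mapVec ψ (p i)) t t' ks ls (ψ C) (fun l => mapVec ψ (π l)) w =
      MvPolynomial.eval₂Hom ψ ![w.1, w.2] (pencil (fun i => mapVec MvPolynomial.C (p i)) t t' ks ls
        (MvPolynomial.C C) (fun l => mapVec MvPolynomial.C (π l))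
        (MvPolynomial.X 0, MvPolynomial.X 1)) := by
  rw [← pencil_map]
  simp [mapVec]

/-- A polynomial identity at a generic point holds at all points. -/
theorem pencil_eq_zero_of_generic {I F K R : Type*} [Field F] [Field K] [Algebra F K] [CommRing R]
    {x y : K} (hxy : AlgebraicIndependent F ![x, y]) {p : I → F × F} {t t' ks ls : List I} {k : ℕ}
    {C : F} {π : Fin k → F × F}
    (h : pencil (fun i => mapVec (algebraMap F K) (p i)) t t' ks ls (algebraMap F K C)
      (fun l => mapVec (algebraMap F K) (π l)) (x, y) = 0) (φ : F →+* R) (w : R × R) :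
    pencil (fun i => mapVec φ (p i)) t t' ks ls (φ C) (fun l => mapVec φ (π l)) w = 0 := by
  rw [pencil_eq_eval₂Hom] at h ⊢
  rw [(algebraicIndependent_iff.1 hxy) _ h, map_zero]

end pencil

/-! ### Distinctness of the intersection points -/

section distinct

open TrivSqZeroExt

variable {I K : Type*} [Field K] {p : I → K × K}

theorem fst_pointProd_inl (l : List I) (u v : K × K) :
    fst (pointProd (fun i => mapVec (inlHom K K) (p i)) l (inl u.1 + inr v.1, inl u.2 + inr v.2)) =
      pointProd p l u := by
  rw [pointProd, fst_prod_det₂]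
  simp [pointProd, mapVec]

/-- The infinitesimal part at $u+\varepsilon v$ is the derivative at $u$ in the direction $v$; like
the value, it is polynomial in data from $F$. -/
theorem snd_pointProd_inl_mem {E : Type*} [Field E] [Algebra E K] (F : IntermediateField E K)
    {l : List I} (hl : ∀ i ∈ l, (p i).1 ∈ F ∧ (p i).2 ∈ F) {u v : K × K} (hu : u.1 ∈ F ∧ u.2 ∈ F)
    (hv : v.1 ∈ F ∧ v.2 ∈ F) : pointProd p l u ∈ F ∧
    snd (pointProd (fun i => mapVec (inlHom K K) (p i)) l
      (inl u.1 + inr v.1, inl u.2 + inr v.2)) ∈ F := by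
  induction l with
  | nil => exact ⟨F.one_mem, by simp [pointProd]⟩
  | cons i l ih =>
    have h1 := ih fun k hk => hl k (List.mem_cons_of_mem _ hk)
    have h2 := hl i List.mem_cons_self
    have h3 {w : K × K} (hw : w.1 ∈ F ∧ w.2 ∈ F) : det₂ w (p i) ∈ F :=
      F.sub_mem (F.mul_mem hw.1 h2.2) (F.mul_mem hw.2 h2.1)
    refine ⟨F.mul_mem (h3 hu) h1.1, ?_⟩
    change snd (det₂ _ _ * pointProd _ l _) ∈ F
    rw [DualNumber.snd_mul, fst_pointProd_inl, snd_det₂, fst_det₂]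
    refine F.add_mem (F.mul_mem ?_ h1.2) (F.mul_mem ?_ h1.1)
    · simpa [mapVec] using h3 hu
    · simpa [mapVec, det₂] using h3 hv

/-- Two products of linear forms, one of which contains a generic factor, do not agree to first
order at a point defined over a field of transcendence degree one. -/
theorem not_pointProd_eq {E : Type*} [Field E] [Algebra E K] {τ : K}
    (hdet : ∀ i k, i ≠ k → det₂ (p i) (p k) ≠ 0) {i : I} {M N : List I}
    (hi : AlgebraicIndependent E ![(p i).1, (p i).2])
    (hE : ∀ k ≠ i, (p k).1 ∈ Set.range (algebraMap E K) ∧ (p k).2 ∈ Set.range (algebraMap E K))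
    (hiM : i ∉ M) (hiN : i ∉ N) (hMN : ∀ k ∈ M, k ∉ N) {u : K × K} (hu0 : u ≠ 0)
    (hu : u.1 ∈ IntermediateField.adjoin E {τ} ∧ u.2 ∈ IntermediateField.adjoin E {τ})
    (h : ∀ v : K × K, pointProd (fun k => mapVec (inlHom K K) (p k)) (i :: M)
        (inl u.1 + inr v.1, inl u.2 + inr v.2) =
      pointProd (fun k => mapVec (inlHom K K) (p k)) N (inl u.1 + inr v.1, inl u.2 + inr v.2)) :
    False := by
  set F := IntermediateField.adjoin E {τ}
  have hF : ∀ k ≠ i, (p k).1 ∈ F ∧ (p k).2 ∈ F := fun k hk => by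
    obtain ⟨⟨a, ha⟩, b, hb⟩ := hE k hk
    exact ⟨ha ▸ F.algebraMap_mem a, hb ▸ F.algebraMap_mem b⟩
  have hM {v : K × K} (hv : v.1 ∈ F ∧ v.2 ∈ F) := snd_pointProd_inl_mem F (l := M)
    (fun k hk => hF k (ne_of_mem_of_not_mem hk hiM)) hu hv
  have hN {v : K × K} (hv : v.1 ∈ F ∧ v.2 ∈ F) := snd_pointProd_inl_mem F (l := N)
    (fun k hk => hF k (ne_of_mem_of_not_mem hk hiN)) hu hv
  have h0 : det₂ u (p i) * pointProd p M u = pointProd p N u := by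
    have := congrArg fst (h 0)
    rwa [fst_pointProd_inl, fst_pointProd_inl] at this
  -- A zero of $M$ at $u$ would be a common zero of $M$ and $N$, which have no index in common.
  -- Division by $M(u)$ then puts $\det(u,p_i)$ in $F$.
  have hM0 : pointProd p M u ≠ 0 := fun h1 =>
    pointProd_ne_zero hdet hMN hu0 h1 (by rw [← h0, h1, mul_zero])
  have hui : det₂ u (p i) ∈ F := by
    rw [eq_div_of_mul_eq hM0 h0]
    exact F.div_mem (hN (v := 0) ⟨F.zero_mem, F.zero_mem⟩).1
      (hM (v := 0) ⟨F.zero_mem, F.zero_mem⟩).1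
  -- The first-order part in the direction $v$ determines $\det(v,p_i)$ from elements of $F$. The
  -- two basis vectors $v$ then put both coordinates of $p_i$ in $E(\tau)$, against their algebraic
  -- independence.
  have key {v : K × K} (hv : v.1 ∈ F ∧ v.2 ∈ F) : det₂ v (p i) ∈ F := by
    have h1 := congrArg snd (h v)
    change snd (det₂ _ _ * pointProd _ M _) = _ at h1
    rw [DualNumber.snd_mul, fst_pointProd_inl, snd_det₂, fst_det₂] at h1
    have h2 : det₂ v (p i) * pointProd p M u = snd (pointProd (fun k => mapVec (inlHom K K) (p k)) N
        (inl u.1 + inr v.1, inl u.2 + inr v.2)) - det₂ u (p i) *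
        snd (pointProd (fun k => mapVec (inlHom K K) (p k)) M
          (inl u.1 + inr v.1, inl u.2 + inr v.2)) := by
      rw [← h1]
      simp [mapVec, det₂]
    rw [eq_div_of_mul_eq hM0 h2]
    exact F.div_mem (F.sub_mem (hN hv).2 (F.mul_mem hui (hM hv).2)) (hM hv).1
  refine not_algebraicIndependent_pair (τ := τ) ?_ ?_ hi
  · simpa [det₂] using F.neg_mem (key (v := (0, 1)) ⟨F.zero_mem, F.one_mem⟩)
  · simpa [det₂] using key (v := (1, 0)) ⟨F.one_mem, F.zero_mem⟩

/-- The members of a pencil that contains a generic linear form have no multiple roots. -/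
theorem det₂_ne_zero_of_pencil {E : Type*} [Field E] [Algebra E K] {is ks ls : List I} {s k : ℕ}
    {π : Fin k → K × K} {C : K} (hdet : ∀ i k, i ≠ k → det₂ (p i) (p k) ≠ 0)
    (hnd : (is ++ ks ++ ls).Nodup)
    (hpoly : ∀ (φ : K →+* DualNumber K) (w : DualNumber K × DualNumber K),
      pencil (fun i => mapVec φ (p i)) (is.take s) (is.drop s) ks ls (φ C)
        (fun l => mapVec φ (π l)) w = 0)
    (hπ0 : ∀ l, π l ≠ 0) {i : I} (hi : i ∈ is)
    (hind : AlgebraicIndependent E ![(p i).1, (p i).2])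
    (hE : ∀ k ≠ i, (p k).1 ∈ Set.range (algebraMap E K) ∧ (p k).2 ∈ Set.range (algebraMap E K))
    {l m : Fin k} (hlm : l ≠ m) : det₂ (π l) (π m) ≠ 0 := by
  classical
  intro h0
  -- Only the projective point matters: rescaled to $(\tau,1)$ or $(1,0)$, it is defined over the
  -- simple extension $E(\tau)$.
  obtain ⟨τ, u, hu0, hu, hul⟩ : ∃ (τ : K) (u : K × K), u ≠ 0 ∧
      (u.1 ∈ IntermediateField.adjoin E {τ} ∧ u.2 ∈ IntermediateField.adjoin E {τ}) ∧
      det₂ (π l) u = 0 := by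
    rcases eq_or_ne (π l).2 0 with h2 | h2
    · refine ⟨0, (1, 0), by simp, ⟨one_mem _, zero_mem _⟩, by simp [det₂, h2]⟩
    · refine ⟨(π l).1 / (π l).2, ((π l).1 / (π l).2, 1), by simp,
        ⟨IntermediateField.mem_adjoin_simple_self E _, one_mem _⟩, ?_⟩
      simp only [det₂]
      field_simp
      ring
  have hum := det₂_eq_zero_of_eq_zero (hπ0 l) hul h0
  have hlu : det₂ u (π l) = 0 := by
    simp only [det₂] at hul ⊢
    linear_combination -hul
  -- If $\pi_l$ and $\pi_m$ are proportional, two factors on the right vanish at $u$. The right side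
  -- then vanishes to first order, so both products agree at every $u+\varepsilon v$.
  have hprod : ∀ v : K × K, pointProd (fun i => mapVec (inlHom K K) (p i)) (is.take s ++ (ks ++ ks))
        (inl u.1 + inr v.1, inl u.2 + inr v.2) =
      pointProd (fun i => mapVec (inlHom K K) (p i)) (is.drop s ++ (ls ++ ls))
        (inl u.1 + inr v.1, inl u.2 + inr v.2) := by
    intro v
    have h1 := hpoly (inlHom K K) (inl u.1 + inr v.1, inl u.2 + inr v.2)
    rw [pencil, ← Finset.mul_prod_erase _ _ (Finset.mem_univ l),
      ← Finset.mul_prod_erase _ _ (Finset.mem_erase.2 ⟨hlm.symm, Finset.mem_univ m⟩),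
      ← mul_assoc (det₂ _ _)] at h1
    have h2 : det₂ (inl u.1 + inr v.1, inl u.2 + inr v.2) (mapVec (inlHom K K) (π l)) *
        det₂ (inl u.1 + inr v.1, inl u.2 + inr v.2) (mapVec (inlHom K K) (π m)) =
        (0 : DualNumber K) := by
      have h3 : ∀ n, det₂ u (π n) = 0 → fst (det₂ ((inl u.1 + inr v.1, inl u.2 + inr v.2) :
          DualNumber K × DualNumber K) (mapVec (inlHom K K) (π n))) = 0 := fun n hn => by
        rw [fst_det₂]
        simpa [mapVec] using hn
      ext
      · rw [fst_mul, h3 l hlu, zero_mul, fst_zero]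
      · rw [DualNumber.snd_mul, h3 l hlu, h3 m hum, zero_mul, mul_zero, add_zero, snd_zero]
    rw [h2, zero_mul, mul_zero, sub_zero, sub_eq_zero] at h1
    simpa only [pointProd_append, ← sq] using h1
  have hdisj := disjoint_of_nodup hnd s
  have hnd' : (is.take s ++ is.drop s ++ ks ++ ls).Nodup := by rwa [List.take_append_drop]
  have hperm {t : List I} (r : List I) (hit : i ∈ t) (w : DualNumber K × DualNumber K) :
      pointProd (fun i => mapVec (inlHom K K) (p i)) (t ++ r) w =
      pointProd (fun i => mapVec (inlHom K K) (p i)) (i :: (t.erase i ++ r)) w :=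
    (((List.perm_cons_erase hit).append_right r).map _).prod_eq
  rw [← List.take_append_drop s is, List.mem_append] at hi
  simp only [List.nodup_append, List.mem_append] at hnd' hdisj
  rcases hi with hi | hi
  · refine not_pointProd_eq hdet hind hE (M := (is.take s).erase i ++ (ks ++ ks)) ?_ ?_ ?_ hu0 hu
      fun v => (hperm _ hi _).symm.trans (hprod v)
    · simp only [List.mem_append, hnd'.1.1.1.mem_erase_iff]
      grind
    · simp only [List.mem_append]
      grind
    · simp only [List.mem_append, hnd'.1.1.1.mem_erase_iff]
      grind
  · refine not_pointProd_eq hdet hind hE (M := (is.drop s).erase i ++ (ls ++ ls)) ?_ ?_ ?_ hu0 hu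
      fun v => (hperm _ hi _).symm.trans (hprod v).symm
    · simp only [List.mem_append, hnd'.1.1.2.1.mem_erase_iff]
      grind
    · simp only [List.mem_append]
      grind
    · simp only [List.mem_append, hnd'.1.1.2.1.mem_erase_iff]
      grind

/-- The two members of a pencil that span it are different. -/
theorem pencil_ne_zero {is ks ls : List I} {s : ℕ} (hdet : ∀ i k, i ≠ k → det₂ (p i) (p k) ≠ 0)
    (hnd : (is ++ ks ++ ls).Nodup) (his : is ≠ []) :
    ∃ w, pencil p (is.take s) (is.drop s) ks ls 0 (k := 0) ![] w ≠ 0 := by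
  obtain ⟨b, hb⟩ := List.exists_mem_of_ne_nil _ his
  -- At a point $p_b$ with $b$ among the $i$'s exactly one of the two products vanishes. With $C=0$
  -- and no roots, `pencil` is their plain difference.
  refine ⟨p b, fun h => ?_⟩
  rw [pencil, zero_mul, sub_zero, sub_eq_zero] at h
  have hdisj := disjoint_of_nodup hnd s
  have hself {l : List I} (hl : b ∈ l) : pointProd p l (p b) = 0 :=
    List.prod_eq_zero (List.mem_map.2 ⟨b, hl, by simp [det₂, mul_comm]⟩)
  have key {l : List I} (h0 : pointProd p l (p b) = 0) : b ∈ l := by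
    obtain ⟨i, hi, hi0⟩ := exists_of_pointProd_eq_zero h0
    rcases eq_or_ne b i with rfl | hbi
    · exact hi
    · exact absurd hi0 (hdet b i hbi)
  rw [← List.take_append_drop s is, List.mem_append] at hb
  simp only [List.mem_append] at hdisj
  rcases hb with hb | hb
  · rw [hself hb, zero_mul, eq_comm, mul_eq_zero, pow_eq_zero_iff two_ne_zero] at h
    exact hdisj b (Or.inl hb) (h.imp key key)
  · rw [hself hb, zero_mul, mul_eq_zero, pow_eq_zero_iff two_ne_zero] at h
    exact hdisj b (h.imp key key) (Or.inl hb)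

end distinct

theorem pencil_congr {I R : Type*} [CommRing R] {p p' : I → R × R} {t t' ks ls : List I} {k : ℕ}
    {C : R} {π : Fin k → R × R} (w : R × R)
    (hp : ∀ i, i ∈ t ∨ i ∈ t' ∨ i ∈ ks ∨ i ∈ ls → p i = p' i) :
    pencil p t t' ks ls C π w = pencil p' t t' ks ls C π w := by
  have key : ∀ l : List I, (∀ i ∈ l, p i = p' i) → pointProd p l w = pointProd p' l w :=
    fun l hl => congrArg List.prod (List.map_congr_left fun i hi => by rw [hl i hi])
  rw [pencil, key t fun i hi => hp i (by tauto), key t' fun i hi => hp i (by tauto),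
    key ks fun i hi => hp i (by tauto), key ls fun i hi => hp i (by tauto), pencil]

/-- A polynomial identity with coefficients in a subfield at a generic point holds at all points. -/
theorem pencil_eq_zero_of_mem {I E K R : Type*} [Field E] [Field K] [Algebra E K] [CommRing R]
    (F : IntermediateField E K) {x : K × K} (hx : AlgebraicIndependent F ![x.1, x.2])
    {p : I → K × K} {t t' ks ls : List I} {k : ℕ} {C : K} {π : Fin k → K × K}
    (hp : ∀ i, i ∈ t ∨ i ∈ t' ∨ i ∈ ks ∨ i ∈ ls → (p i).1 ∈ F ∧ (p i).2 ∈ F) (hC : C ∈ F)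
    (hπ : ∀ l, (π l).1 ∈ F ∧ (π l).2 ∈ F) (h : pencil p t t' ks ls C π x = 0) (φ : K →+* R)
    (w : R × R) :
    pencil (fun i => mapVec φ (p i)) t t' ks ls (φ C) (fun l => mapVec φ (π l)) w = 0 := by
  classical
  -- Points outside the four lists, such as the generic one, need not be defined over `F`; they get
  -- the harmless value `0`.
  set pF : I → F × F := fun i =>
    if hi : (p i).1 ∈ F ∧ (p i).2 ∈ F then (⟨(p i).1, hi.1⟩, ⟨(p i).2, hi.2⟩) else 0
  have hpF : ∀ i, i ∈ t ∨ i ∈ t' ∨ i ∈ ks ∨ i ∈ ls → p i = mapVec (algebraMap F K) (pF i) :=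
    fun i hi => by simp only [pF, dif_pos (hp i hi)]; rfl
  rw [pencil_congr x hpF] at h
  rw [pencil_congr (p' := fun i => mapVec (φ.comp (algebraMap F K)) (pF i)) w
    fun i hi => by rw [hpF i hi]; rfl]
  exact pencil_eq_zero_of_generic hx (C := ⟨C, hC⟩)
    (π := fun l => (⟨(π l).1, (hπ l).1⟩, ⟨(π l).2, (hπ l).2⟩)) h (φ.comp (algebraMap F K)) w

/-! ### Field of definition, independence and constancy of the central coordinates -/

section coords

variable {h : ℂ} {I : Type*} [LinearOrder I] {Q : Type*} [DivisionRing Q] [Algebra ℂ Q]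
  {j : HAlg h I →ₐ[ℂ] Q} {L : Type*} [DivisionRing L] [Algebra ℂ L] (e : Q →ₐ[ℂ] L)
  {z : I → L × L} (hz : ∀ i, z i = (e (j (coordX h i)), e (j (coordY h i))))
  {b : I} {A B : I → Subring.center L} (hA : ∀ i, (A i : L) = br h (z i) (z b))
  (hB : ∀ i, (B i : L) = (z i).2 * ((z b).2)⁻¹)

include hz hA hB

theorem coords_mem_centralPart {o i : I} (hb : b ≠ o) (hi : i ≠ o) :
    A i ∈ centralPart ((subQuot j {k | k ≠ o}).map (e : Q →+* L)) ∧
      B i ∈ centralPart ((subQuot j {k | k ≠ o}).map (e : Q →+* L)) := by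
  have hD : ∀ k, k ≠ o → (z k).1 ∈ (subQuot j {k | k ≠ o}).map (e : Q →+* L) ∧
      (z k).2 ∈ (subQuot j {k | k ≠ o}).map (e : Q →+* L) := fun k hk => by
    rw [hz]
    exact ⟨⟨_, subQuot.coordX_mem hk, rfl⟩, ⟨_, subQuot.coordY_mem hk, rfl⟩⟩
  rw [mem_centralPart, mem_centralPart, hA, hB, (hPair_coords e hz i b).br_eq]
  exact ⟨sub_mem (mul_mem (hD i hi).1 (hD b hb).2) (mul_mem (hD b hb).1 (hD i hi).2),
    mul_mem (hD i hi).2 (inv_mem (hD b hb).2)⟩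

theorem coords_det₂_ne_zero (hQ : IsRightQuotientDivisionRing j) {i k : I} (hik : i ≠ k) :
    det₂ (A i, B i) (A k, B k) ≠ 0 := fun h0 => by
  have hw := coords_snd_ne_zero e hz hQ b
  have hp := hPair_coords e hz b
  have := coords_br_ne_zero e hz hQ hik
  rw [(hp i).pt_eq hw (hA i) (hB i), (hp k).pt_eq hw (hA k) (hB k), br_pt (hp b) hw, h0] at this
  exact this rfl

theorem dK_coords_eq_zero {K : Set I} {S : Set L} (hb : b ∉ K)
    {i : I} (hi : i ∉ K) : dK h z K S (A i) = 0 ∧ dK h z K S (B i) = 0 := by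
  have h1 := dK_base (h := h) (z := z) (S := S) hb
  have h2 := dK_base (h := h) (z := z) (S := S) hi
  rw [hA, hB, (hPair_coords e hz i b).br_eq, dK_sub, dK_mul, dK_mul, dK_mul, h1.1, h1.2, h2.1, h2.2,
    dK_inv_eq_zero h1.2]
  simp only [lact_zero, ract_zero, add_zero, sub_zero, and_self]

end coords

end HDeformed

end

/-! ### The deformed Abel theorem -/

open HDeformed in
theorem theorem23
    -- the deformation parameter, the ordered index set with the distinguished index `0`,
    -- and the set `K` of the indices of the variable points
    (h : ℂ) (h_ne : h ≠ 0) {I : Type*} [LinearOrder I] (o : I) (K : Set I) (ho : o ∈ K)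
    -- the genus, the indices `i₁, …, i_{2g+2}`, `j₁, …, j_{g-1}`, `k₁, …, k_p`, `l₁, …, l_q`
    (g : ℕ) (hg : 1 ≤ g) (is js ks ls : List I)
    (his : is.length = 2 * g + 2) (hjs : js.length = g - 1)
    (his_const : ∀ i ∈ is, i ∉ K) (hjs_const : ∀ i ∈ js, i ∉ K)
    (hks_var : ∀ i ∈ ks, i ∈ K ∧ i ≠ o) (hls_var : ∀ i ∈ ls, i ∈ K ∧ i ≠ o)
    (hdistinct : (is ++ ks ++ ls).Nodup)
    -- the number `s` with `p - q = g + 1 - s`, and the degree `k`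
    (s : ℕ) (hs : s ≤ 2 * g + 2)
    (hpq : (ks.length : ℤ) - (ls.length : ℤ) = (g : ℤ) + 1 - (s : ℤ))
    (k : ℕ) (hk : k = s + 2 * ks.length)
    -- the right quotient division ring `Q = Q_I` of `H_I`
    {Q : Type*} [DivisionRing Q] [Algebra ℂ Q] (j : HDeformed.HAlg h I →ₐ[ℂ] Q)
    (hQ : HDeformed.IsRightQuotientDivisionRing j)
    -- a skew field `L` over `Q_I` and the coordinates `(x_i, y_i)` of the points in `L`
    {L : Type*} [DivisionRing L] [Algebra ℂ L] (e : Q →ₐ[ℂ] L)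
    (z : I → L × L)
    (hz : ∀ i, z i = (e (j (HDeformed.coordX h i)), e (j (HDeformed.coordY h i))))
    -- central elements `Sg` of `L`, algebraic over the skew subfield `Q_{I∖{0}}`
    (Sg : Set L) (hSg_central : ∀ σ ∈ Sg, ∀ a : L, σ * a = a * σ)
    (hSg_alg : ∀ σ ∈ Sg, ∃ (n : ℕ) (c : Fin n → Q),
      (∀ m, c m ∈ HDeformed.subQuot j {i | i ≠ o}) ∧
        σ ^ n + ∑ m : Fin n, e (c m) * σ ^ (m : ℕ) = 0)
    -- the decomposition of `r` into central linear forms `(0 X_i) = x Y_i - y X_i - h y Y_i`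
    -- with coefficients in `Q_{I∖{0}}[Sg]`
    (X Y : Fin k → L) (C : L)
    (hX : ∀ i, X i ∈ Algebra.adjoin ℂ (e '' (HDeformed.subQuot j {i | i ≠ o} : Set Q) ∪ Sg))
    (hY : ∀ i, Y i ∈ Algebra.adjoin ℂ (e '' (HDeformed.subQuot j {i | i ≠ o} : Set Q) ∪ Sg))
    (hC : C ∈ Algebra.adjoin ℂ (e '' (HDeformed.subQuot j {i | i ≠ o} : Set Q) ∪ Sg))
    (hcentral : ∀ i, ∀ a : L,
      HDeformed.br h (z o) (X i, Y i) * a = a * HDeformed.br h (z o) (X i, Y i))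
    (hr : HDeformed.brProd h z (z o) (is.take s) * HDeformed.brProd h z (z o) ks ^ 2
        - HDeformed.brProd h z (z o) (is.drop s) * HDeformed.brProd h z (z o) ls ^ 2
      = C * (List.ofFn fun i => HDeformed.br h (z o) (X i, Y i)).prod)
    -- central square roots `W_i` of `(X_i i₁)⋯(X_i i_{2g+2})`
    (W : Fin k → L) (hW_central : ∀ i, ∀ a : L, W i * a = a * W i)
    (hW : ∀ i, W i ^ 2 = HDeformed.brProd h z (X i, Y i) is)
    -- `L` is generated over `Q_I` by `Sg` and the `W_i`
    (hL : Algebra.adjoin ℂ (Set.range e ∪ Sg ∪ Set.range W) = ⊤) :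
    ∃ ε : Fin k → ℤ, (∀ i, ε i = 1 ∨ ε i = -1) ∧
      ∑ i, ε i • HDeformed.dh h z K (Sg ∪ Set.range W) js (W i) (X i, Y i) = 0 := by
  rw [Set.union_assoc] at hL
  have hT : ∀ t ∈ Sg ∪ Set.range W, ∀ a, t * a = a * t := by
    rintro t (ht | ⟨i, rfl⟩)
    · exact hSg_central t ht
    · exact hW_central i
  -- Three of the at least four indices in `is` get special roles: `b` is the base point, `i₁` the
  -- generic point that excludes multiple roots, and `i₂` the auxiliary direction of the
  -- translations.
  obtain ⟨b, i₁, l, rfl⟩ : ∃ b i₁ l, is = b :: i₁ :: l := by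
    rcases is with _ | ⟨b, _ | ⟨i₁, l⟩⟩
    · simp at his
    · simp at his
    · exact ⟨b, i₁, l, rfl⟩
  obtain ⟨i₂, l, rfl⟩ : ∃ i₂ l', l = i₂ :: l' := by
    rcases l with _ | ⟨i₂, l⟩
    · simp at his
      omega
    · exact ⟨i₂, l, rfl⟩
  have hi₂ : i₂ ∈ b :: i₁ :: i₂ :: l := by simp
  have hne : b ≠ i₁ ∧ i₂ ≠ i₁ ∧ i₂ ≠ b := by
    simp only [List.cons_append, List.nodup_cons, List.mem_cons, not_or] at hdistinct
    exact ⟨hdistinct.1.1, Ne.symm hdistinct.2.1.1, Ne.symm hdistinct.1.2.1⟩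
  obtain ⟨hbi₁, hi₂i₁, hi₂b⟩ := hne
  have hi₁ : i₁ ∈ b :: i₁ :: i₂ :: l := by simp
  have hbK : b ∉ K := his_const b (by simp)
  have his0 : b :: i₁ :: i₂ :: l ≠ [] := List.cons_ne_nil _ _
  generalize b :: i₁ :: i₂ :: l = is at *
  have hiso : ∀ i ∈ is, i ≠ o := fun i hi hio => his_const i hi (hio ▸ ho)
  have hbo : b ≠ o := fun hbo => hbK (hbo ▸ ho)
  have hi₂o := hiso i₂ hi₂
  obtain ⟨A, B, hA, hB⟩ := exists_central_coords e hz hQ hT hL b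
  have hw := coords_snd_ne_zero e hz hQ b
  have hbb := hPair_coords e hz b b
  have hzpt : ∀ i, z i = pt (z b) (A i, B i) := fun i =>
    (hPair_coords e hz b i).pt_eq hw (hA i) (hB i)
  set p : I → Subring.center L × Subring.center L := fun i => (A i, B i) with hp
  have hdet : ∀ i k, i ≠ k → det₂ (p i) (p k) ≠ 0 := fun i k hik =>
    coords_det₂_ne_zero e hz hA hB hQ hik
  have hbrProd : ∀ v l, brProd h z (pt (z b) v) l = ((pointProd p l v : Subring.center L) : L) :=
    brProd_pt hbb hw hzpt
  -- the coefficient field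
  set D := (subQuot j {i | i ≠ o}).map (e : Q →+* L) with hDdef
  have hDimage : e '' (subQuot j {i | i ≠ o} : Set Q) = (D : Set L) := rfl
  rw [hDimage] at hC
  simp only [hDimage] at hX hY
  have hD : ∀ q ∈ D, (∀ a ∈ D, a * q = q * a) → q ∈ Subring.center L := fun q _ hq =>
    mem_center_of_commute_sub e hz hQ hT hL hA hB hbo hq
  have hDalg : ∀ c, algebraMap ℂ L c ∈ D := fun c =>
    ⟨algebraMap ℂ Q c, subQuot.algebraMap_mem _ c, e.commutes c⟩
  have hSg : ∀ σ ∈ Sg, ∃ x ∈ algPart D, (x : L) = σ := fun σ hσ => by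
    obtain ⟨n, c, hc, hσc⟩ := hSg_alg σ hσ
    refine ⟨⟨σ, Subring.mem_center_iff.2 fun a => (hSg_central σ hσ a).symm⟩, ?_, rfl⟩
    exact mem_algebraicClosure_iff.2
      (isAlgebraic_of_relation hD (c := fun m => e (c m)) (fun m => ⟨c m, hc m, rfl⟩) hσc)
  have hpF : ∀ i, i ≠ o → (p i).1 ∈ algPart D ∧ (p i).2 ∈ algPart D := fun i hi => by
    have := coords_mem_centralPart e hz hA hB hbo hi
    exact ⟨(algPart D).algebraMap_mem ⟨_, this.1⟩, (algPart D).algebraMap_mem ⟨_, this.2⟩⟩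
  have hpF' : ∀ i, i ∈ is.take s ∨ i ∈ is.drop s ∨ i ∈ ks ∨ i ∈ ls →
      (p i).1 ∈ algPart D ∧ (p i).2 ∈ algPart D := by
    rintro i (hi | hi | hi | hi)
    · exact hpF i (hiso i (List.mem_of_mem_take hi))
    · exact hpF i (hiso i (List.mem_of_mem_drop hi))
    · exact hpF i (hks_var i hi).2
    · exact hpF i (hls_var i hi).2
  have hgen : AlgebraicIndependent (algPart D) ![(p o).1, (p o).2] :=
    (algebraicIndependent_coords e hz hA hB hQ hbo hi₂o hi₂b).algebraicClosure
  -- the points at which the form `r` vanishes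
  choose π hπ hπF using fun l =>
    exists_central_point e hz hQ hT hL hA hB hbo hi₂o hi₂b hSg (hX l) (hY l) (hcentral l)
  simp only [hπ] at hr hW ⊢
  rw [hzpt o] at hr
  simp only [hbrProd, br_pt hbb hw] at hr hW
  -- With $C=0$ and no roots, `pencil` is the form $r$ itself, evaluated at the central coordinates
  -- of the point $0$.
  set r : Subring.center L := pencil p (is.take s) (is.drop s) ks ls 0 (k := 0) ![] (p o) with hrdef
  have hr' : (r : L) = C * ((∏ l, det₂ (p o) (π l) : Subring.center L) : L) := by
    rw [hrdef, pencil, zero_mul, sub_zero, ← List.prod_ofFn, ← Subring.coe_subtype, map_list_prod,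
      List.map_ofFn]
    exact hr
  -- The point $0$ is generic over the coefficients, so $r=0$ would make the two products agree at
  -- every point.
  have hr0 : r ≠ 0 := fun h0 => by
    obtain ⟨w, hw⟩ := pencil_ne_zero (s := s) hdet hdistinct his0
    refine hw (Eq.trans ?_
      (pencil_eq_zero_of_mem (algPart D) hgen hpF' (zero_mem _) (fun l => l.elim0) h0
        (RingHom.id _) w))
    rfl
  have hP0 : ∏ l, det₂ (p o) (π l) ≠ 0 := fun h0 => hr0 (Subtype.ext (by
    rw [hr', h0]; exact mul_zero _))
  -- The factor $C$ is central, being the quotient of the central $r$ by the central product of the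
  -- linear forms; lying in $D[\Sigma]$, it is then algebraic.
  set C' : Subring.center L := r * (∏ l, det₂ (p o) (π l))⁻¹ with hC'
  have hC'C : (C' : L) = C := by
    rw [hC', Subring.coe_mul, hr', mul_assoc, ← Subring.coe_mul, mul_inv_cancel₀ hP0]
    exact mul_one _
  have hC'0 : C' ≠ 0 := mul_ne_zero hr0 (inv_ne_zero hP0)
  have hC'F : C' ∈ algPart D := mem_algPart_of_mem_adjoin hD hDalg hSg (hC'C ▸ hC)
  have hπ0 : ∀ l, π l ≠ 0 := fun l hl => hP0 (Finset.prod_eq_zero (Finset.mem_univ l) (by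
    rw [hl]; simp [det₂]))
  have hpoly {R : Type _} [CommRing R] (φ : Subring.center L →+* R) (w : R × R) :
      pencil (fun i => mapVec φ (p i)) (is.take s) (is.drop s) ks ls (φ C')
        (fun l => mapVec φ (π l)) w = 0 := by
    refine pencil_eq_zero_of_mem (algPart D) hgen hpF' hC'F hπF ?_ φ w
    rw [pencil, hC', inv_mul_cancel_right₀ hP0, hrdef, pencil, zero_mul, sub_zero, sub_self]
  have hne : ∀ l m, l ≠ m → det₂ (π l) (π m) ≠ 0 := fun l m hlm => by
    -- Here the field of constants is the central part of $Q_{I\setminus\{i_1\}}$ for the index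
    -- `i₁`: all other points are defined over it, and the point `i₁` is generic.
    refine det₂_ne_zero_of_pencil (E := centralPart ((subQuot j {i | i ≠ i₁}).map (e : Q →+* L)))
      hdet hdistinct hpoly hπ0 hi₁ ?_ (fun i hi => ?_) hlm
    · exact algebraicIndependent_coords e hz hA hB hQ hbi₁ hi₂i₁ hi₂b
    · have := coords_mem_centralPart e hz hA hB hbi₁ hi
      exact ⟨⟨⟨_, this.1⟩, rfl⟩, ⟨⟨_, this.2⟩, rfl⟩⟩
  -- Abel's theorem over the center
  set ω : Fin k → Subring.center L := fun l =>
    ⟨W l, Subring.mem_center_iff.2 fun a => (hW_central l a).symm⟩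
  have hω : ∀ l, ω l ^ 2 = pointProd p is (π l) := fun l => Subtype.ext (hW l)
  -- The degree condition $(g-1)+p+q+2=s+2p$ is equivalent to $p-q=g+1-s$.
  obtain ⟨ε, hε, hsum⟩ := exists_signs_sum_eq_zero (js := js) hdet hdistinct
    (fun φ w => sub_eq_zero.1 (hpoly φ w)) hπ0 hC'0 hne hω (by omega)
  refine ⟨ε, hε, eq_zero_of_forall_functional (L := L) fun f hf => ?_⟩
  -- Each functional $f$ supplies the derivation $f\circ d$ of the center; it kills the coordinates
  -- of the constant points $i_1,\dots,i_{2g+2}$.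
  rw [map_sum, ← hsum (fun c => f (dK h z K (Sg ∪ Set.range W) c))
    (fun a c => by rw [Subring.coe_add, dK_add, map_add])
    (functional_dK_mul e hz hQ hL hA hB hbK hf) fun i hi => by
      have := dK_coords_eq_zero (h := h) (S := Sg ∪ Set.range W) e hz hA hB hbK (his_const i hi)
      simp only [hp, this.1, this.2, map_zero, and_self]]
  refine Finset.sum_congr rfl fun l _ => ?_
  rw [map_zsmul]
  exact congrArg _ (functional_dh e hz hQ hL hA hB hbK hf js (ω l) (π l))
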